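/- **Setting.** Let $G=(\mathcal V,\mathcal E)$ be a finite metric graph. Each edge $e$ has an origin and a terminus in $\mathcal V$ and a length $\ell_e\in(0,\infty)$, and is parameterised by arc length $x\in[0,\ell_e]$, with $x=0$ at the origin and $x=\ell_e$ at the terminus. Write $e\sim v$ if an end of $e$ is attached to $v$; at this end let $s_e^v=-1$ if $v$ is the origin of $e$ and $s_e^v=1$ if $v$ is the terminus of $e$, and let $u_e(v)$, $u_e'(v)$ be the values (limits along the edge) of $u_e$, $u_e'$ there, derivatives being taken in $x$. (Sums over $e\sim v$ run over the edge ends attached to $v$; if $e$ is a loop, its two ends are treated separately.) Let $a>0$, $\kappa\in(0,\infty)$, masses $\mathfrak m_v>0$ for $v\in\mathcal V$, and real-valued potentials $q_e\in L^2(0,\ell_e)$ for $e\in\mathcal E$ be given. Let $$L^2(G)=\bigoplus_{e\in\mathcal E}L^2(0,\ell_e)\ \oplus\ \bigoplus_{v\in\mathcal V}\mathbb C,\qquad \big\langle (u,u^\circ),(w,w^\circ)\big\rangle=\sum_{e}\int_0^{\ell_e}u_e\overline{w_e}\,dx+\sum_{v}\mathfrak m_v\,u_v^\circ\,\overline{w_v^\circ}.$$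 The energy of $(u,u^\circ)\in\prod_e H^1(e)\times\prod_v\mathbb C$ is $$\mathcal U(u,u^\circ)=\sum_{e}\frac12\int_0^{\ell_e}\big(a|u_e'|^2+q_e|u_e|^2\big)dx+\sum_{v}\frac12\sum_{e\sim v}\kappa\,|u_v^\circ-u_e(v)|^2 ,$$ and $h$ denotes the sesquilinear form on $\prod_e H^1(e)\times\prod_v\mathbb C$ with $h\big((u,u^\circ),(u,u^\circ)\big)=2\,\mathcal U(u,u^\circ)$ (free vertices: no condition is imposed on the form domain). **Theorem.** There is a densely defined self-adjoint operator $\mathcal A$ in $L^2(G)$ with compact resolvent that is associated with the energy form: for $X,Y\in L^2(G)$, one has $X\in\operatorname{dom}\mathcal A$ and $\mathcal AX=Y$ if and only if $X$ lies in the form domain $\prod_e H^1(e)\times\prod_v\mathbb C$ and $h(X,W)=\langle Y,W\rangle$ for every $W$ in the form domain. The domain of $\mathcal A$ consists exactly of those $(u,u^\circ)\in\prod_{e}H^2(e)\times\prod_{v}\mathbb C$ that satisfy, at each vertex $v$ and for all $e\sim v$, the non-homogeneous Robin (semi-rigidity) conditions $$u_e(v)+s_e^v\,a\,\kappa^{-1}u_e'(v)=u_v^\circ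 ,$$ and on this domain $\mathcal A$ acts as $$\big((u_e)_{e},(u_v^\circ)_{v}\big)\mapsto\big((-a u_e''+q_e u_e)_{e},(\mathfrak m_v^{-1}F_v)_{v}\big),\qquad F_v=\sum_{e\sim v}s_e^v\,a\,u_e'(v).$$ -/

import Mathlib

open MeasureTheory ComplexConjugate

noncomputable section

/-- A compact (finite) metric graph with vertex set `V` and edge set `E`, together with the
coefficients of the model. The edge `e` is parameterised by arc length `x ∈ [0, len e]`, with
`x = 0` at its origin and `x = len e` at its terminus. -/
structure SemirigidGraph (V E : Type*) where
  /-- the origin of an edge -/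
  origin : E → V
  /-- the terminus of an edge -/
  terminus : E → V
  /-- the length of an edge -/
  len : E → ℝ
  len_pos : ∀ e, 0 < len e
  /-- the stiffness `a`, common to all edges -/
  a : ℝ
  a_pos : 0 < a
  /-- the rigidity parameter `κ ∈ (0, ∞)` -/
  kappa : ℝ
  kappa_pos : 0 < kappa
  /-- the real potential `q_e`, square integrable on each edge -/
  q : E → ℝ → ℝ
  q_memLp : ∀ e, MemLp (q e) 2 (volume.restrict (Set.Ioc 0 (len e)))
  /-- the concentrated mass at a vertex -/
  mass : V → ℝ
  mass_pos : ∀ v, 0 < mass v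

namespace SemirigidGraph

variable {V E : Type*} (G : SemirigidGraph V E)

/-- Lebesgue measure on the edge `e`. -/
abbrev edgeMeasure (e : E) : Measure ℝ := volume.restrict (Set.Ioc 0 (G.len e))

/-! ### The ends of the edges

An edge end is a pair `p = (e, b)`: the origin end of `e` for `b = false`, the terminus end for
`b = true`. The relation `e ∼ v` is that an end of `e` is attached to `v` (a loop has two ends
at its vertex). -/

/-- The vertex to which an edge end is attached. -/
def endVertex (p : E × Bool) : V := if p.2 then G.terminus p.1 else G.origin p.1

/-- The arc-length coordinate of an edge end. -/
def endCoord (p : E × Bool) : ℝ := if p.2 then G.len p.1 else 0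

/-- The sign of the outward direction at an edge end: `-1` at the origin, `1` at the terminus. -/
def endSign (p : E × Bool) : ℝ := if p.2 then 1 else -1

/-! ### Sobolev spaces

An element of `H¹(e)` is given by its continuous representative, which is the integral of a
square-integrable function, its weak derivative. An element of `H²(e)` is an element of `H¹(e)`
whose derivative is in `H¹(e)`; the derivative is then also given by its continuous
representative, so its values at the two ends are the limits along the edge. -/

/-- The space `∏_e H¹(e) × ∏_v ℂ`. Only the values of `val e` on `[0, len e]`, and those of
`der e` almost everywhere there, matter. -/
structure H1 (G : SemirigidGraph V E) where
  /-- the functions `u_e` -/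
  val : E → ℝ → ℂ
  /-- the derivatives `u_e'` -/
  der : E → ℝ → ℂ
  /-- the vertex values `u_v°` -/
  vert : V → ℂ
  der_memLp : ∀ e, MemLp (der e) 2 (G.edgeMeasure e)
  val_eq : ∀ e, ∀ x ∈ Set.Icc 0 (G.len e), val e x = val e 0 + ∫ t in (0 : ℝ)..x, der e t

/-- The space `∏_e H²(e) × ∏_v ℂ`. -/
structure H2 (G : SemirigidGraph V E) extends H1 G where
  /-- the second derivatives `u_e''` -/
  der2 : E → ℝ → ℂ
  der2_memLp : ∀ e, MemLp (der2 e) 2 (G.edgeMeasure e)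
  der_eq : ∀ e, ∀ x ∈ Set.Icc 0 (G.len e), der e x = der e 0 + ∫ t in (0 : ℝ)..x, der2 e t


theorem H1.val_memLp {G : SemirigidGraph V E} (u : G.H1) (e : E) : MemLp (u.val e) 2 (G.edgeMeasure e) := by
  have hint : IntegrableOn (u.der e) (Set.Icc 0 (G.len e)) := by
    rw [integrableOn_Icc_iff_integrableOn_Ioc]
    exact (u.der_memLp e).integrable one_le_two
  have hc : ContinuousOn (u.val e) (Set.Icc 0 (G.len e)) := by
    refine ContinuousOn.congr (f := fun x => u.val e 0 + ∫ t in (0 : ℝ)..x, u.der e t) ?_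
      (u.val_eq e)
    have := intervalIntegral.continuousOn_primitive_interval (a := 0) (b := G.len e)
      (f := u.der e) (μ := volume) (by rwa [Set.uIcc_of_le (G.len_pos e).le])
    rw [Set.uIcc_of_le (G.len_pos e).le] at this
    exact continuousOn_const.add this
  obtain ⟨C, hC⟩ := isCompact_Icc.exists_bound_of_continuousOn hc
  have hm : AEStronglyMeasurable (u.val e) (G.edgeMeasure e) :=
    (hc.aestronglyMeasurable measurableSet_Icc).mono_measure
      (Measure.restrict_mono Set.Ioc_subset_Icc_self le_rfl)
  exact MemLp.of_bound hm C ((ae_restrict_iff' measurableSet_Ioc).2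
    (Filter.Eventually.of_forall fun x hx => hC x (Set.Ioc_subset_Icc_self hx)))

/-! ### The Hilbert space `L²(G)` -/

/-- The space of vertex values `(c_v)_{v ∈ V}`, with the inner product
`∑ v, m_v * conj (c_v) * d_v` weighted by the masses. -/
def VertexSpace (_G : SemirigidGraph V E) : Type _ := V → ℂ

instance : AddCommGroup G.VertexSpace := inferInstanceAs (AddCommGroup (V → ℂ))

instance : Module ℂ G.VertexSpace := inferInstanceAs (Module ℂ (V → ℂ))

variable [Fintype V]

instance : FiniteDimensional ℂ G.VertexSpace := inferInstanceAs (FiniteDimensional ℂ (V → ℂ))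

/-- The weighted inner product on the vertex values. -/
@[reducible] def vertexCore : InnerProductSpace.Core ℂ G.VertexSpace where
  inner c d := ∑ v, (G.mass v : ℂ) * (conj (c v) * d v)
  conj_inner_symm c d := by
    simp only [map_sum, map_mul, Complex.conj_ofReal, Complex.conj_conj]
    exact Finset.sum_congr rfl fun v _ => by ring
  re_inner_nonneg c := by
    simp only [map_sum]
    refine Finset.sum_nonneg fun v _ => ?_
    rw [← Complex.normSq_eq_conj_mul_self, ← Complex.ofReal_mul]
    exact mul_nonneg (G.mass_pos v).le (Complex.normSq_nonneg _)
  add_left c d x := by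
    rw [← Finset.sum_add_distrib]
    refine Finset.sum_congr rfl fun v _ => ?_
    change (G.mass v : ℂ) * (conj (c v + d v) * x v) = _
    rw [map_add]; ring
  smul_left c d r := by
    rw [Finset.mul_sum]
    refine Finset.sum_congr rfl fun v _ => ?_
    change (G.mass v : ℂ) * (conj (r * c v) * d v) = _
    rw [map_mul]; ring
  definite c h := by
    have h' : ∑ v, G.mass v * Complex.normSq (c v) = 0 := by
      have h2 : ((∑ v, G.mass v * Complex.normSq (c v) : ℝ) : ℂ) = 0 := by
        rw [← h, Complex.ofReal_sum]
        refine Finset.sum_congr rfl fun v _ => ?_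
        rw [Complex.ofReal_mul, Complex.normSq_eq_conj_mul_self]
      exact_mod_cast h2
    funext v
    have hv := (Finset.sum_eq_zero_iff_of_nonneg fun v _ =>
      mul_nonneg (G.mass_pos v).le (Complex.normSq_nonneg (c v))).1 h' v (Finset.mem_univ v)
    exact Complex.normSq_eq_zero.1 ((mul_eq_zero.1 hv).resolve_left (G.mass_pos v).ne')

instance : NormedAddCommGroup G.VertexSpace :=
  InnerProductSpace.Core.toNormedAddCommGroup (cd := G.vertexCore)

instance : InnerProductSpace ℂ G.VertexSpace := InnerProductSpace.ofCore G.vertexCore.toCore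

theorem vertexSpace_inner (c d : G.VertexSpace) :
    inner ℂ c d = ∑ v, (G.mass v : ℂ) * (conj (c v) * d v) := rfl

instance : CompleteSpace G.VertexSpace := FiniteDimensional.complete ℂ G.VertexSpace

variable [Fintype E]

/-- `L²(G) = (⨁_e L²(0, len e)) ⊕ ⨁_v ℂ`, the vertex part being weighted by the masses. The
parts of `x : G.L2` are `x.fst e` and `x.snd v`. -/
abbrev L2 : Type _ :=
  WithLp 2 (PiLp 2 (fun e : E => Lp ℂ 2 (G.edgeMeasure e)) × G.VertexSpace)

variable {G}

/-- The element of `L²(G)` defined by an element of `∏_e H¹(e) × ∏_v ℂ`. -/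
def H1.toL2 (u : G.H1) : G.L2 :=
  WithLp.toLp 2 (WithLp.toLp 2 fun e => (u.val_memLp e).toLp (u.val e), u.vert)

/-- The jump `u_v° - u_e(v)` at an edge end. -/
def H1.jump (u : G.H1) (p : E × Bool) : ℂ := u.vert (G.endVertex p) - u.val p.1 (G.endCoord p)

/-! ### The energy -/

variable [DecidableEq V]

/-- The edge ends attached to the vertex `v`. -/
def endsAt (G : SemirigidGraph V E) (v : V) : Finset (E × Bool) :=
  Finset.univ.filter fun p => G.endVertex p = v

/-- The total energy: the sum over the edges of `½ ∫_e (a |u'|² + q |u|²)`, plus the sum over the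
vertices of `½ ∑_{e ∼ v} κ |u_v° - u_e(v)|²`. -/
def energy (u : G.H1) : ℝ :=
  (∑ e, 1 / 2 * ∫ x in (0 : ℝ)..G.len e,
      (G.a * ‖u.der e x‖ ^ 2 + G.q e x * ‖u.val e x‖ ^ 2)) +
    ∑ v, 1 / 2 * ∑ p ∈ G.endsAt v, G.kappa * ‖u.jump p‖ ^ 2

/-- The sesquilinear form of the energy, on the form domain `∏_e H¹(e) × ∏_v ℂ` (free vertices:
no condition is imposed there). -/
def energyForm (u w : G.H1) : ℂ :=
  (∑ e, ∫ x in (0 : ℝ)..G.len e,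
      ((G.a : ℂ) * (u.der e x * conj (w.der e x)) +
        (G.q e x : ℂ) * (u.val e x * conj (w.val e x)))) +
    ∑ v, ∑ p ∈ G.endsAt v, (G.kappa : ℂ) * (u.jump p * conj (w.jump p))

theorem energyForm_self (u : G.H1) : energyForm u u = ((2 * energy u : ℝ) : ℂ) := by
  simp only [energyForm, energy, Complex.mul_conj, Complex.normSq_eq_norm_sq, mul_add,
    Finset.mul_sum, ← mul_assoc]
  norm_num
  refine Finset.sum_congr rfl fun e _ => ?_
  rw [← intervalIntegral.integral_ofReal]
  simp

/-- `A` is the operator associated with the energy form `h`: `x` is in the domain of `A` with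
`A x = y` if and only if `x` is in the form domain and `h(x, w) = ⟨y, w⟩` for every `w` in the
form domain. -/
def IsEnergyOperator (A : G.L2 →ₗ.[ℂ] G.L2) : Prop :=
  ∀ x y : G.L2, (x, y) ∈ A.graph ↔
    ∃ u : G.H1, u.toL2 = x ∧ ∀ w : G.H1, energyForm u w = inner ℂ w.toL2 y

/-! ### The differential operator -/

/-- The semi-rigidity conditions `u_e(v) + s κ⁻¹ a u_e'(v) = u_v°` at all edge ends. -/
def H2.IsSemirigid (u : G.H2) : Prop :=
  ∀ v, ∀ p ∈ G.endsAt v,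
    u.val p.1 (G.endCoord p) +
      ((endSign p * G.a * G.kappa⁻¹ : ℝ) : ℂ) * u.der p.1 (G.endCoord p) = u.vert v

/-- The net force `F_v = ∑_{e ∼ v} s a u_e'(v)` at the vertex `v`. -/
def H2.netForce (u : G.H2) (v : V) : ℂ :=
  ∑ p ∈ G.endsAt v, ((endSign p * G.a : ℝ) : ℂ) * u.der p.1 (G.endCoord p)

end SemirigidGraph

/-! ### Resolvents of unbounded operators -/

/-- `R` is a bounded two-sided inverse of `A - z`, that is, `R = (A - z)⁻¹` and `z` is in the
resolvent set of `A`. -/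
def IsResolventAt {H : Type*} [NormedAddCommGroup H] [NormedSpace ℂ H]
    (A : H →ₗ.[ℂ] H) (z : ℂ) (R : H →L[ℂ] H) : Prop :=
  (∀ y : H, ∃ h : R y ∈ A.domain, A ⟨R y, h⟩ - z • R y = y) ∧
    ∀ x : A.domain, R (A x - z • (x : H)) = x

/-- The resolvent set of `A` is not empty, and all resolvents of `A` are compact operators. -/
def HasCompactResolvent {H : Type*} [NormedAddCommGroup H] [NormedSpace ℂ H]
    (A : H →ₗ.[ℂ] H) : Prop :=
  (∃ z R, IsResolventAt A z R) ∧ ∀ z R, IsResolventAt A z R → IsCompactOperator R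

end

/-!
The proof is the form method for a form that is bounded below, made concrete by the fact that the
graph is one-dimensional.

An element `u` of `H¹(0, ℓ)` is the pair `(u 0, u')` in `ℂ × L²(0, ℓ)`, so the form domain
`∏_e H¹(e) × ∏_v ℂ` becomes a Hilbert space `FormSpace`, and the energy form is `⟪w, T u⟫` for a
bounded symmetric operator `T` on it (`formOperator`). The embedding `J` of the form domain into
`L²(G)` (`formEmbed`) has dense range, because test functions are in `H¹`, and it is compact,
because freezing a primitive on the cells of a partition gives finite-rank operators that converge to it in
norm. The one-dimensional Sobolev inequality `√ℓ |u x| ≤ ‖u‖ + ℓ ‖u'‖` shows that the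
square-integrable potential is harmless; hence `T + c J* J` is coercive for large `c`, and so
invertible (`exists_form_coercive`). Then `R = J (T + c J* J)⁻¹ J*` is compact, symmetric and injective, and
`{(x, y) | R (y + c x) = x}` is the graph of the required self-adjoint operator
(`exists_selfAdjoint_of_form`).

For the domain, the form is integrated by parts with the derivative of the test function left alone:
testing with `w = w 0 + ∫ w'` gives the equation `a u' + ∫_x^ℓ (q u - y) = κ (u° - u(ℓ))` at once,
together with the balance of forces on each edge and at each vertex (`formOperator_eq_iff`). Read in
one direction this is elliptic regularity and the semi-rigidity condition (`H2.exists_of_weak`), in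
the other it says that a semi-rigid `H²` function solves the weak equation (`H2.weak_of_semirigid`).
-/

noncomputable section

open scoped InnerProductSpace

/-! ### Self-adjoint operators from forms -/

section AbstractOperator

variable {H K : Type*} [NormedAddCommGroup H] [InnerProductSpace ℂ H] [CompleteSpace H]
  [NormedAddCommGroup K] [InnerProductSpace ℂ K] [CompleteSpace K]

/-- An injective compact symmetric operator `R` is the resolvent, at the real point `-c`, of a
self-adjoint operator, whose graph is `{(x, y) | R (y + c x) = x}`. -/
theorem exists_selfAdjoint_of_resolvent (R : H →L[ℂ] H) (c : ℝ)
    (hsymm : ∀ x y, ⟪R x, y⟫_ℂ = ⟪x, R y⟫_ℂ) (hinj : ∀ x, R x = 0 → x = 0)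
    (hcomp : IsCompactOperator R) :
    ∃ A : H →ₗ.[ℂ] H, (∀ x y, (x, y) ∈ A.graph ↔ R (y + (c : ℂ) • x) = x) ∧
      Dense (A.domain : Set H) ∧ IsSelfAdjoint A ∧ HasCompactResolvent A := by
  let g : Submodule ℂ (H × H) :=
    LinearMap.ker ((R : H →ₗ[ℂ] H).comp (LinearMap.snd ℂ H H + (c : ℂ) • LinearMap.fst ℂ H H)
      - LinearMap.fst ℂ H H)
  have hg : ∀ x y, (x, y) ∈ g ↔ R (y + (c : ℂ) • x) = x := fun x y => by
    simp [g, sub_eq_zero]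
  have hfun : ∀ (p : H × H) (_ : p ∈ g) (_ : p.1 = 0), p.2 = 0 := by
    rintro ⟨x, y⟩ hp rfl
    exact hinj y (by simpa using (hg 0 y).1 hp)
  have hgraph : ∀ x y, (x, y) ∈ g.toLinearPMap.graph ↔ R (y + (c : ℂ) • x) = x := fun x y => by
    rw [Submodule.toLinearPMap_graph_eq g hfun, hg]
  -- `R` is a left and a right inverse of `A + c`
  have hA : ∀ x : g.toLinearPMap.domain, R (g.toLinearPMap x + (c : ℂ) • (x : H)) = x :=
    fun x => (hgraph _ _).1 (g.toLinearPMap.mem_graph x)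
  have hR : ∀ z, ∃ h : R z ∈ g.toLinearPMap.domain,
      g.toLinearPMap ⟨R z, h⟩ = z - (c : ℂ) • R z := fun z => by
    have h1 : (R z, z - (c : ℂ) • R z) ∈ g.toLinearPMap.graph := by
      rw [hgraph, sub_add_cancel]
    obtain ⟨x, hx, hx'⟩ := (LinearPMap.mem_graph_iff _).1 h1
    obtain ⟨x, hxd⟩ := x
    simp only at hx hx'
    subst hx
    exact ⟨hxd, hx'⟩
  have hdense : Dense (g.toLinearPMap.domain : Set H) := by
    rw [Submodule.dense_iff_topologicalClosure_eq_top,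
      Submodule.topologicalClosure_eq_top_iff, Submodule.eq_bot_iff]
    intro z hz
    refine hinj z (ext_inner_left ℂ fun y => ?_)
    rw [inner_zero_right, ← hsymm]
    exact (Submodule.mem_orthogonal _ _).1 hz _ (hR y).1
  refine ⟨g.toLinearPMap, hgraph, hdense, ?_, ⟨-c, R, ?_, ?_⟩, ?_⟩
  · refine le_antisymm ?_ (LinearPMap.IsFormalAdjoint.le_adjoint hdense ?_)
    · refine LinearPMap.le_of_le_graph ?_
      rintro ⟨x, y⟩ hxy
      obtain ⟨x', rfl, rfl⟩ := (LinearPMap.mem_graph_iff _).1 hxy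
      rw [hgraph]
      -- a vector of the adjoint domain is tested against the range of `R`
      refine ext_inner_right ℂ fun z => ?_
      obtain ⟨hz, hz'⟩ := hR z
      have := LinearPMap.adjoint_isFormalAdjoint hdense x' ⟨R z, hz⟩
      rw [hz', inner_sub_right, inner_smul_right] at this
      rw [hsymm, inner_add_left, inner_smul_left, Complex.conj_ofReal]
      exact add_eq_of_eq_sub this
    · intro x y
      have hx := hA x
      have hy := hA y
      have key := hsymm (g.toLinearPMap x + (c : ℂ) • (x : H))
        (g.toLinearPMap y + (c : ℂ) • (y : H))
      rw [hx, hy, inner_add_left, inner_add_right, inner_smul_left, inner_smul_right,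
        Complex.conj_ofReal] at key
      exact (add_right_cancel key).symm
  · intro z
    obtain ⟨hz, hz'⟩ := hR z
    exact ⟨hz, by rw [hz']; simp⟩
  · intro x
    simpa using hA x
  · rintro z S ⟨hS, -⟩
    -- the resolvent identity `S = R + (z + c) R S`
    have hSR : S = R.comp (ContinuousLinearMap.id ℂ H + (z + (c : ℂ)) • S) := by
      ext y
      obtain ⟨hy, hy'⟩ := hS y
      have := hA ⟨S y, hy⟩
      rw [sub_eq_iff_eq_add.1 hy'] at this
      simp only [ContinuousLinearMap.comp_apply, add_apply,
        ContinuousLinearMap.id_apply, smul_apply, add_smul]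
      rw [← add_assoc]
      exact this.symm
    rw [hSR]
    exact hcomp.comp_clm _

/-- The form method: `J : K → H` embeds the form domain, and the form is `(u, w) ↦ ⟪w, T u⟫`.
If it is bounded below relative to `J`, it is the form of a self-adjoint operator. That the range
of `J` is dense is expressed by its orthogonal complement. -/
theorem exists_selfAdjoint_of_form (J : K →L[ℂ] H) (T : K →L[ℂ] K)
    (hJd : ∀ y, (∀ k, ⟪J k, y⟫_ℂ = 0) → y = 0)
    (hJc : IsCompactOperator J) (hT : ∀ u w, ⟪T u, w⟫_ℂ = ⟪u, T w⟫_ℂ) {c d : ℝ} (hd : 0 < d)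
    (hcoer : ∀ k, d * ‖k‖ ^ 2 ≤ RCLike.re ⟪k, T k⟫_ℂ + c * ‖J k‖ ^ 2) :
    ∃ A : H →ₗ.[ℂ] H,
      (∀ x y, (x, y) ∈ A.graph ↔ ∃ k, J k = x ∧ ∀ w, ⟪w, T k⟫_ℂ = ⟪J w, y⟫_ℂ) ∧
      Dense (A.domain : Set H) ∧ IsSelfAdjoint A ∧ HasCompactResolvent A := by
  set S : K →L[ℂ] K := T + (c : ℂ) • (J.adjoint.comp J) with hS
  have hSapp : ∀ k, S k = T k + (c : ℂ) • J.adjoint (J k) := fun k => by simp [hS]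
  have hSre : ∀ k, d * ‖k‖ ^ 2 ≤ RCLike.re ⟪k, S k⟫_ℂ := fun k => by
    refine (hcoer k).trans (le_of_eq ?_)
    rw [hSapp, inner_add_right, inner_smul_right, ContinuousLinearMap.adjoint_inner_right,
      inner_self_eq_norm_sq_to_K, map_add]
    simp [← Complex.ofReal_pow]
  have hSsymm : ∀ u w, ⟪S u, w⟫_ℂ = ⟪u, S w⟫_ℂ := fun u w => by
    rw [hSapp, hSapp, inner_add_left, inner_add_right, hT, inner_smul_left, inner_smul_right,
      Complex.conj_ofReal, ContinuousLinearMap.adjoint_inner_right,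
      ContinuousLinearMap.adjoint_inner_left]
  have hunit : IsUnit S := by
    refine ContinuousLinearMap.isUnit_of_forall_le_norm_inner_map S (c := ⟨d, hd.le⟩) hd
      fun k => ?_
    rw [hSsymm, mul_comm]
    exact (hSre k).trans (RCLike.re_le_norm _)
  obtain ⟨U, hU⟩ := hunit
  set B : K →L[ℂ] K := (↑U⁻¹ : K →L[ℂ] K) with hB
  have hSB : ∀ k, S (B k) = k := fun k => by
    rw [← hU, hB, ← mul_apply_eq_comp, Units.mul_inv, one_apply_eq_self]
  have hBS : ∀ k, B (S k) = k := fun k => by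
    rw [← hU, hB, ← mul_apply_eq_comp, Units.inv_mul, one_apply_eq_self]
  have hBsymm : ∀ u w, ⟪B u, w⟫_ℂ = ⟪u, B w⟫_ℂ := fun u w => by
    conv_lhs => rw [← hSB w]
    rw [← hSsymm, hSB]
  set R : H →L[ℂ] H := J.comp (B.comp J.adjoint) with hR
  have hRapp : ∀ z, R z = J (B (J.adjoint z)) := fun z => rfl
  obtain ⟨A, hA, hA'⟩ := exists_selfAdjoint_of_resolvent R c
    (fun x y => by
      rw [hRapp, hRapp, ← ContinuousLinearMap.adjoint_inner_right, hBsymm,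
        ContinuousLinearMap.adjoint_inner_left])
    (fun z hz => by
      -- coercivity at `(T + c J* J)⁻¹ J* z` turns `R z = 0` into `J* z = 0`
      have h1 : J.adjoint z = 0 := by
        have h2 := hSre (B (J.adjoint z))
        rw [hSB, ContinuousLinearMap.adjoint_inner_right, ← hRapp, hz, inner_zero_left,
          map_zero] at h2
        have h3 : B (J.adjoint z) = 0 := by
          by_contra h
          have := norm_pos_iff.2 h
          have : 0 < d * ‖B (J.adjoint z)‖ ^ 2 := by positivity
          linarith
        rw [← hSB (J.adjoint z), h3, map_zero]
      refine hJd z fun k => ?_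
      rw [← ContinuousLinearMap.adjoint_inner_right, h1, inner_zero_right])
    (hJc.comp_clm _)
  refine ⟨A, fun x y => ?_, hA'⟩
  rw [hA]
  have hweak : ∀ k, (∀ w, ⟪w, T k⟫_ℂ = ⟪J w, y⟫_ℂ) ↔ T k = J.adjoint y := fun k => by
    simp_rw [← ContinuousLinearMap.adjoint_inner_right]
    exact ⟨fun h => ext_inner_left ℂ h, fun h w => by rw [h]⟩
  simp_rw [hweak]
  constructor
  · intro h
    refine ⟨B (J.adjoint (y + (c : ℂ) • x)), h, ?_⟩
    have h1 := hSapp (B (J.adjoint (y + (c : ℂ) • x)))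
    rw [← hRapp, h, hSB, map_add J.adjoint y, map_smul] at h1
    rw [map_add, map_smul]
    exact (add_right_cancel h1).symm
  · rintro ⟨k, rfl, hk⟩
    rw [hRapp, map_add, map_smul, ← hk, ← hSapp, hBS]

end AbstractOperator

/-! ### The Sobolev space of an interval -/

section Edge

/-- Lebesgue measure on the interval `(0, ℓ]`. -/
abbrev lebesgueIoc (ℓ : ℝ) : Measure ℝ := volume.restrict (Set.Ioc 0 ℓ)

/-- Exchange of the order of integration over the triangle `0 < t ≤ x ≤ ℓ`; this is integration
by parts against a primitive. -/
theorem integral_mul_primitive {ℓ : ℝ} {p g : ℝ → ℂ}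
    (hp : Integrable p (lebesgueIoc ℓ)) (hg : Integrable g (lebesgueIoc ℓ)) :
    ∫ x, p x * (∫ t in (0 : ℝ)..x, g t) ∂lebesgueIoc ℓ =
      ∫ t, (∫ x in t..ℓ, p x) * g t ∂lebesgueIoc ℓ := by
  have hS : MeasurableSet {z : ℝ × ℝ | z.2 ≤ z.1} := measurableSet_le measurable_snd measurable_fst
  have hF : Integrable ({z : ℝ × ℝ | z.2 ≤ z.1}.indicator fun z => p z.1 * g z.2)
      ((lebesgueIoc ℓ).prod (lebesgueIoc ℓ)) := (hp.mul_prod hg).indicator hS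
  have hswap := integral_integral_swap (μ := lebesgueIoc ℓ) (ν := lebesgueIoc ℓ)
    (f := fun x t => {z : ℝ × ℝ | z.2 ≤ z.1}.indicator (fun z => p z.1 * g z.2) (x, t)) hF
  refine Eq.trans ?_ (hswap.trans ?_)
  · refine setIntegral_congr_fun measurableSet_Ioc fun x hx => ?_
    have h1 : (fun t => {z : ℝ × ℝ | z.2 ≤ z.1}.indicator (fun z => p z.1 * g z.2) (x, t)) =
        (Set.Iic x).indicator fun t => p x * g t := by
      ext t; simp [Set.indicator_apply]
    simp only [h1]
    rw [integral_indicator measurableSet_Iic, Measure.restrict_restrict measurableSet_Iic,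
      Set.inter_comm, Set.Ioc_inter_Iic, min_eq_right hx.2, integral_const_mul,
      intervalIntegral.integral_of_le hx.1.le]
  · refine setIntegral_congr_fun measurableSet_Ioc fun t ht => ?_
    have h1 : (fun x => {z : ℝ × ℝ | z.2 ≤ z.1}.indicator (fun z => p z.1 * g z.2) (x, t)) =
        (Set.Ici t).indicator fun x => p x * g t := by
      ext x; simp [Set.indicator_apply]
    have h2 : Set.Ici t ∩ Set.Ioc 0 ℓ = Set.Icc t ℓ := by
      ext x; simp only [Set.mem_inter_iff, Set.mem_Ici, Set.mem_Ioc, Set.mem_Icc]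
      exact ⟨fun h => ⟨h.1, h.2.2⟩, fun h => ⟨h.1, ht.1.trans_le h.1, h.2⟩⟩
    simp only [h1]
    rw [integral_indicator measurableSet_Ici, Measure.restrict_restrict measurableSet_Ici, h2,
      integral_Icc_eq_integral_Ioc, integral_mul_const, intervalIntegral.integral_of_le ht.2]

/-- The Sobolev space `H¹(0, ℓ)`, an element `u` being given by the pair `(u 0, u')`. -/
abbrev EdgeSpace (ℓ : ℝ) : Type := ℂ × Lp ℂ 2 (lebesgueIoc ℓ)

/-- The evaluation functional `u ↦ u x`, for `x` in `[0, ℓ]`. -/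
def evalAt (ℓ x : ℝ) : EdgeSpace ℓ →L[ℂ] ℂ :=
  ContinuousLinearMap.fst ℂ _ _ +
    (innerSL ℂ (indicatorConstLp 2 (μ := lebesgueIoc ℓ) (s := Set.Ioc 0 x) measurableSet_Ioc
      (measure_ne_top _ _) (1 : ℂ))).comp (ContinuousLinearMap.snd ℂ _ _)

variable {ℓ : ℝ}

theorem inner_indicator_Ioc {x y : ℝ} (hy : 0 ≤ y) (hyx : y ≤ x) (hx : x ≤ ℓ)
    (g : Lp ℂ 2 (lebesgueIoc ℓ)) :
    ⟪indicatorConstLp 2 (μ := lebesgueIoc ℓ) (s := Set.Ioc y x) measurableSet_Ioc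
      (measure_ne_top _ _) (1 : ℂ), g⟫_ℂ = ∫ t in y..x, g t := by
  rw [L2.inner_indicatorConstLp_one, Measure.restrict_restrict measurableSet_Ioc,
    Set.inter_eq_left.2 (Set.Ioc_subset_Ioc hy hx), intervalIntegral.integral_of_le hyx]

theorem norm_integral_le_sqrt {x y : ℝ} (hy : 0 ≤ y) (hyx : y ≤ x) (hx : x ≤ ℓ)
    (g : Lp ℂ 2 (lebesgueIoc ℓ)) : ‖∫ t in y..x, g t‖ ≤ √(x - y) * ‖g‖ := by
  rw [← inner_indicator_Ioc hy hyx hx]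
  refine (norm_inner_le_norm _ _).trans (le_of_eq ?_)
  rw [norm_indicatorConstLp two_ne_zero ENNReal.ofNat_ne_top, measureReal_def,
    Measure.restrict_apply measurableSet_Ioc,
    Set.inter_eq_left.2 (Set.Ioc_subset_Ioc hy hx), Real.volume_Ioc,
    ENNReal.toReal_ofReal (sub_nonneg.2 hyx), Real.sqrt_eq_rpow]
  simp

theorem evalAt_apply {x : ℝ} (hx : x ∈ Set.Icc 0 ℓ) (k : EdgeSpace ℓ) :
    evalAt ℓ x k = k.1 + ∫ t in (0 : ℝ)..x, k.2 t := by
  rw [← inner_indicator_Ioc le_rfl hx.1 hx.2]; rfl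

theorem Lp_intervalIntegrable (g : Lp ℂ 2 (lebesgueIoc ℓ)) {x y : ℝ} (hx : x ∈ Set.Icc 0 ℓ)
    (hy : y ∈ Set.Icc 0 ℓ) : IntervalIntegrable g volume x y := by
  have h : IntegrableOn g (Set.Ioc 0 ℓ) := (Lp.memLp g).integrable one_le_two
  rw [intervalIntegrable_iff]
  exact h.mono_set (Set.Ioc_subset_Ioc (le_min hx.1 hy.1) (max_le hx.2 hy.2))

theorem norm_evalAt_sub_le {x y : ℝ} (hx : x ∈ Set.Icc 0 ℓ) (hy : y ∈ Set.Icc 0 ℓ)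
    (k : EdgeSpace ℓ) : ‖evalAt ℓ x k - evalAt ℓ y k‖ ≤ √|x - y| * ‖k.2‖ := by
  wlog h : y ≤ x generalizing x y
  · rw [norm_sub_rev, abs_sub_comm]
    exact this hy hx (le_of_not_ge h)
  have h0 : (0 : ℝ) ∈ Set.Icc 0 ℓ := ⟨le_rfl, hx.1.trans hx.2⟩
  rw [evalAt_apply hx, evalAt_apply hy, add_sub_add_left_eq_sub,
    intervalIntegral.integral_interval_sub_left (Lp_intervalIntegrable _ h0 hx)
      (Lp_intervalIntegrable _ h0 hy), abs_of_nonneg (sub_nonneg.2 h)]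
  exact norm_integral_le_sqrt hy.1 h hx.2 _

theorem norm_evalAt_le {x : ℝ} (hx : x ∈ Set.Icc 0 ℓ) (k : EdgeSpace ℓ) :
    ‖evalAt ℓ x k‖ ≤ (1 + √ℓ) * ‖k‖ := by
  have h1 := norm_integral_le_sqrt le_rfl hx.1 hx.2 k.2
  rw [evalAt_apply hx]
  have h2 : √(x - 0) ≤ √ℓ := Real.sqrt_le_sqrt (by simpa using hx.2)
  calc _ ≤ ‖k.1‖ + ‖∫ t in (0 : ℝ)..x, k.2 t‖ := norm_add_le _ _
    _ ≤ ‖k‖ + √ℓ * ‖k‖ := by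
        gcongr
        · exact norm_fst_le k
        · exact h1.trans (mul_le_mul h2 (norm_snd_le k) (norm_nonneg _) (Real.sqrt_nonneg _))
    _ = _ := by ring

theorem continuousOn_evalAt (k : EdgeSpace ℓ) :
    ContinuousOn (fun x => evalAt ℓ x k) (Set.Icc 0 ℓ) := by
  rcases lt_or_ge ℓ 0 with h | h
  · rw [Set.Icc_eq_empty (not_le.2 h)]; exact continuousOn_empty _
  refine ContinuousOn.congr ?_ fun x hx => evalAt_apply hx k
  have := intervalIntegral.continuousOn_primitive_interval (a := 0) (b := ℓ) (f := k.2)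
    (μ := volume) (by
      rw [Set.uIcc_of_le h, integrableOn_Icc_iff_integrableOn_Ioc]
      exact (Lp.memLp k.2).integrable one_le_two)
  rw [Set.uIcc_of_le h] at this
  exact continuousOn_const.add this

theorem ae_mem_Ioc (ℓ : ℝ) : ∀ᵐ x ∂lebesgueIoc ℓ, x ∈ Set.Ioc 0 ℓ :=
  ae_restrict_mem measurableSet_Ioc

theorem memLp_mul_evalAt {m : ℝ → ℂ} (hm : MemLp m 2 (lebesgueIoc ℓ)) (k : EdgeSpace ℓ) :
    MemLp (fun x => m x * evalAt ℓ x k) 2 (lebesgueIoc ℓ) := by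
  refine MemLp.of_le_mul (c := (1 + √ℓ) * ‖k‖) hm (hm.1.mul ?_) ?_
  · exact ((continuousOn_evalAt k).aestronglyMeasurable measurableSet_Icc).mono_measure
      (Measure.restrict_mono Set.Ioc_subset_Icc_self le_rfl)
  · filter_upwards [ae_mem_Ioc ℓ] with x hx
    rw [norm_mul, mul_comm]
    exact mul_le_mul_of_nonneg_right (norm_evalAt_le ⟨hx.1.le, hx.2⟩ k) (norm_nonneg _)

/-- The operator `u ↦ m u` from `H¹(0, ℓ)` to `L²(0, ℓ)`, for a square-integrable `m`. -/
def mulEval (m : ℝ → ℂ) (hm : MemLp m 2 (lebesgueIoc ℓ)) :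
    EdgeSpace ℓ →L[ℂ] Lp ℂ 2 (lebesgueIoc ℓ) :=
  LinearMap.mkContinuous
    { toFun := fun k => (memLp_mul_evalAt hm k).toLp
      map_add' := fun k l => by
        rw [← MemLp.toLp_add]
        congr 1; ext x; simp [mul_add]
      map_smul' := fun c k => by
        rw [← MemLp.toLp_const_smul]
        congr 1; ext x; simp; ring }
    ((1 + √ℓ) * ‖hm.toLp m‖) fun k => by
      rw [mul_right_comm]
      refine Lp.norm_le_mul_norm_of_ae_le_mul ?_
      filter_upwards [ae_mem_Ioc ℓ, (memLp_mul_evalAt hm k).coeFn_toLp, hm.coeFn_toLp]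
        with x hx h1 h2
      simp only [LinearMap.coe_mk, AddHom.coe_mk]
      rw [h1, h2, norm_mul, mul_comm]
      exact mul_le_mul_of_nonneg_right (norm_evalAt_le ⟨hx.1.le, hx.2⟩ k) (norm_nonneg _)

theorem mulEval_coeFn {m : ℝ → ℂ} (hm : MemLp m 2 (lebesgueIoc ℓ)) (k : EdgeSpace ℓ) :
    mulEval m hm k =ᵐ[lebesgueIoc ℓ] fun x => m x * evalAt ℓ x k :=
  (memLp_mul_evalAt hm k).coeFn_toLp

theorem norm_mulEval_le {m : ℝ → ℂ} (hm : MemLp m 2 (lebesgueIoc ℓ)) (k : EdgeSpace ℓ) {b : ℝ}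
    (hb : ∀ x ∈ Set.Icc 0 ℓ, ‖evalAt ℓ x k‖ ≤ b) : ‖mulEval m hm k‖ ≤ b * ‖hm.toLp m‖ := by
  refine Lp.norm_le_mul_norm_of_ae_le_mul ?_
  filter_upwards [ae_mem_Ioc ℓ, mulEval_coeFn hm k, hm.coeFn_toLp] with x hx h1 h2
  rw [h1, h2, norm_mul, mul_comm]
  exact mul_le_mul_of_nonneg_right (hb x ⟨hx.1.le, hx.2⟩) (norm_nonneg _)

/-- The finite-rank operator which freezes `u` at the left end of each of the `n` cells of equal
length of `(0, ℓ]`. -/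
def mulEvalApprox (m : ℝ → ℂ) (hm : MemLp m 2 (lebesgueIoc ℓ)) (n : ℕ) :
    EdgeSpace ℓ →L[ℂ] Lp ℂ 2 (lebesgueIoc ℓ) :=
  ∑ i ∈ Finset.range n, (evalAt ℓ (i * (ℓ / n))).smulRight
    ((hm.indicator (s := Set.Ioc (i * (ℓ / n)) ((i + 1) * (ℓ / n))) measurableSet_Ioc).toLp)

theorem mulEvalApprox_coeFn {m : ℝ → ℂ} (hm : MemLp m 2 (lebesgueIoc ℓ)) (n : ℕ)
    (k : EdgeSpace ℓ) : mulEvalApprox m hm n k =ᵐ[lebesgueIoc ℓ] fun x =>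
      ∑ i ∈ Finset.range n, evalAt ℓ (i * (ℓ / n)) k *
        (Set.Ioc (i * (ℓ / n)) ((i + 1) * (ℓ / n))).indicator m x := by
  rw [mulEvalApprox, sum_apply]
  have h : ∀ i : ℕ, ∀ᵐ x ∂lebesgueIoc ℓ, (((evalAt ℓ (i * (ℓ / n))).smulRight
      ((hm.indicator (s := Set.Ioc (i * (ℓ / n)) ((i + 1) * (ℓ / n)))
        measurableSet_Ioc).toLp)) k) x = evalAt ℓ (i * (ℓ / n)) k *
          (Set.Ioc (i * (ℓ / n)) ((i + 1) * (ℓ / n))).indicator m x := fun i => by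
    rw [ContinuousLinearMap.smulRight_apply]
    filter_upwards [Lp.coeFn_smul (evalAt ℓ (i * (ℓ / n)) k) ((hm.indicator
      (s := Set.Ioc (i * (ℓ / n)) ((i + 1) * (ℓ / n))) measurableSet_Ioc).toLp),
      (hm.indicator (s := Set.Ioc (i * (ℓ / n)) ((i + 1) * (ℓ / n)))
        measurableSet_Ioc).coeFn_toLp] with x h1 h2
    rw [h1, Pi.smul_apply, h2, smul_eq_mul]
  filter_upwards [Lp.coeFn_finsetSum (Finset.range n) fun i : ℕ =>
    ((evalAt ℓ (i * (ℓ / n))).smulRight ((hm.indicator (s := Set.Ioc (i * (ℓ / n))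
      ((i + 1) * (ℓ / n))) measurableSet_Ioc).toLp)) k, ae_all_iff.2 h] with x h1 h2
  rw [h1, Finset.sum_apply]
  exact Finset.sum_congr rfl fun i _ => h2 i

theorem isCompactOperator_smulRight {X Y : Type*} [NormedAddCommGroup X] [NormedSpace ℂ X]
    [NormedAddCommGroup Y] [NormedSpace ℂ Y] (f : X →L[ℂ] ℂ) (y : Y) :
    IsCompactOperator (f.smulRight y) :=
  (isCompactOperator_of_locallyCompactSpace_dom f).clm_comp
    (ContinuousLinearMap.toSpanSingleton ℂ y)

theorem isCompactOperator_sum {X Y ι : Type*} [NormedAddCommGroup X] [NormedSpace ℂ X]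
    [NormedAddCommGroup Y] [NormedSpace ℂ Y] (s : Finset ι) (f : ι → X →L[ℂ] Y)
    (hf : ∀ i ∈ s, IsCompactOperator (f i)) : IsCompactOperator (∑ i ∈ s, f i : X →L[ℂ] Y) := by
  rw [FunLike.coe_sum]
  exact Finset.sum_induction _ (fun g : X → Y => IsCompactOperator g) (fun _ _ h h' => h.add h')
    isCompactOperator_zero hf

theorem norm_mulEval_sub_approx_le (hℓ : 0 < ℓ) {m : ℝ → ℂ} (hm : MemLp m 2 (lebesgueIoc ℓ))
    {n : ℕ} (hn : 0 < n) :
    ‖mulEval m hm - mulEvalApprox m hm n‖ ≤ √(ℓ / n) * ‖hm.toLp m‖ := by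
  refine ContinuousLinearMap.opNorm_le_bound _ (by positivity) fun k => ?_
  rw [mul_right_comm, sub_apply]
  refine Lp.norm_le_mul_norm_of_ae_le_mul ?_
  filter_upwards [ae_mem_Ioc ℓ, mulEval_coeFn hm k, mulEvalApprox_coeFn hm n k, hm.coeFn_toLp,
    Lp.coeFn_sub (mulEval m hm k) (mulEvalApprox m hm n k)] with x hx h1 h2 h3 h4
  have hδ : 0 < ℓ / n := by positivity
  have hnδ : n * (ℓ / n) = ℓ := by field_simp
  set δ := ℓ / n with hδd
  -- the cell that contains `x`
  obtain ⟨j, hj⟩ : ∃ j, ⌈x / δ⌉₊ = j + 1 :=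
    ⟨⌈x / δ⌉₊ - 1, (Nat.sub_add_cancel (Nat.ceil_pos.2 (div_pos hx.1 hδ))).symm⟩
  have hj1 : j * δ < x := by
    rw [← lt_div_iff₀ hδ]
    exact Nat.lt_ceil.1 (by omega)
  have hj2 : x ≤ (j + 1) * δ := by
    rw [← div_le_iff₀ hδ]
    have := Nat.le_ceil (x / δ)
    rw [hj] at this
    exact_mod_cast this
  have hjn : j < n := by
    have : (j : ℝ) * δ < n * δ := by rw [hnδ]; exact hj1.trans_le hx.2
    exact_mod_cast lt_of_mul_lt_mul_right this hδ.le
  have hsum : ∑ i ∈ Finset.range n, evalAt ℓ (i * δ) k *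
      (Set.Ioc (i * δ) ((i + 1) * δ)).indicator m x = evalAt ℓ (j * δ) k * m x := by
    rw [Finset.sum_eq_single_of_mem j (Finset.mem_range.2 hjn)]
    · rw [Set.indicator_of_mem (Set.mem_Ioc.2 ⟨hj1, hj2⟩)]
    · intro i _ hij
      rw [Set.indicator_of_notMem, mul_zero]
      rintro ⟨hi1, hi2⟩
      have a1 : (i : ℝ) < j + 1 := lt_of_mul_lt_mul_right (hi1.trans_le hj2) hδ.le
      have a2 : (j : ℝ) < i + 1 := lt_of_mul_lt_mul_right (hj1.trans_le hi2) hδ.le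
      exact hij (by
        have a3 : i < j + 1 := by exact_mod_cast a1
        have a4 : j < i + 1 := by exact_mod_cast a2
        omega)
  rw [h4, Pi.sub_apply, h1, h2, h3, hsum, mul_comm (m x), ← sub_mul, norm_mul]
  refine mul_le_mul_of_nonneg_right ?_ (norm_nonneg _)
  refine (norm_evalAt_sub_le ⟨hx.1.le, hx.2⟩ ⟨by positivity, hj1.le.trans hx.2⟩ k).trans ?_
  refine mul_le_mul (Real.sqrt_le_sqrt ?_) (norm_snd_le k) (norm_nonneg _) (Real.sqrt_nonneg _)
  rw [abs_of_pos (sub_pos.2 hj1)]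
  linarith

theorem isCompactOperator_mulEval (hℓ : 0 < ℓ) {m : ℝ → ℂ} (hm : MemLp m 2 (lebesgueIoc ℓ)) :
    IsCompactOperator (mulEval m hm) := by
  refine isCompactOperator_of_tendsto (l := Filter.atTop) (F := mulEvalApprox m hm) ?_
    (Filter.Eventually.of_forall fun n =>
      isCompactOperator_sum _ _ fun i _ => isCompactOperator_smulRight _ _)
  rw [tendsto_iff_norm_sub_tendsto_zero]
  refine squeeze_zero' (g := fun n : ℕ => √(ℓ / n) * ‖hm.toLp m‖)
    (Filter.Eventually.of_forall fun n => norm_nonneg _) ?_ ?_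
  · filter_upwards [Filter.eventually_gt_atTop 0] with n hn
    rw [norm_sub_rev]
    exact norm_mulEval_sub_approx_le hℓ hm hn
  · have h1 : Filter.Tendsto (fun n : ℕ => √(ℓ / n)) Filter.atTop (nhds 0) := by
      have := (Real.continuous_sqrt.tendsto 0).comp (tendsto_const_div_atTop_nhds_zero_nat ℓ)
      rwa [Real.sqrt_zero] at this
    simpa using h1.mul_const ‖hm.toLp m‖

/-- The embedding of `H¹(0, ℓ)` into `L²(0, ℓ)`. -/
def edgeEmbed (ℓ : ℝ) : EdgeSpace ℓ →L[ℂ] Lp ℂ 2 (lebesgueIoc ℓ) := mulEval 1 (memLp_const 1)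

theorem edgeEmbed_coeFn (k : EdgeSpace ℓ) :
    edgeEmbed ℓ k =ᵐ[lebesgueIoc ℓ] fun x => evalAt ℓ x k := by
  filter_upwards [mulEval_coeFn (ℓ := ℓ) (m := 1) (memLp_const 1) k] with x hx
  rw [edgeEmbed, hx, Pi.one_apply, one_mul]

/-- The one-dimensional Sobolev inequality: the constant function `u x` differs from `u` by
at most `√ℓ ‖u'‖` everywhere, and has norm `√ℓ |u x|`. -/
theorem sqrt_mul_norm_evalAt_le (hℓ : 0 < ℓ) {x : ℝ} (hx : x ∈ Set.Icc 0 ℓ) (k : EdgeSpace ℓ) :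
    √ℓ * ‖evalAt ℓ x k‖ ≤ ‖edgeEmbed ℓ k‖ + ℓ * ‖k.2‖ := by
  have hnorm : ∀ c : ℂ, ‖indicatorConstLp 2 (μ := lebesgueIoc ℓ) MeasurableSet.univ
      (measure_ne_top _ _) c‖ = √ℓ * ‖c‖ := fun c => by
    rw [norm_indicatorConstLp two_ne_zero ENNReal.ofNat_ne_top, measureReal_def,
      Measure.restrict_apply MeasurableSet.univ, Set.univ_inter, Real.volume_Ioc, sub_zero,
      ENNReal.toReal_ofReal hℓ.le, Real.sqrt_eq_rpow, mul_comm]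
    simp
  set f := indicatorConstLp 2 (μ := lebesgueIoc ℓ) MeasurableSet.univ
      (measure_ne_top _ _) (evalAt ℓ x k) with hf
  set f1 := indicatorConstLp 2 (μ := lebesgueIoc ℓ) MeasurableSet.univ
      (measure_ne_top _ _) (1 : ℂ) with hf1
  have h1 : ‖f - edgeEmbed ℓ k‖ ≤ (√ℓ * ‖k.2‖) * ‖f1‖ := by
    refine Lp.norm_le_mul_norm_of_ae_le_mul ?_
    filter_upwards [ae_mem_Ioc ℓ, edgeEmbed_coeFn k, Lp.coeFn_sub f (edgeEmbed ℓ k),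
      indicatorConstLp_coeFn (p := 2) (μ := lebesgueIoc ℓ) (hs := MeasurableSet.univ)
        (hμs := measure_ne_top _ _) (c := evalAt ℓ x k),
      indicatorConstLp_coeFn (p := 2) (μ := lebesgueIoc ℓ) (hs := MeasurableSet.univ)
        (hμs := measure_ne_top _ _) (c := (1 : ℂ))] with y hy h1 h2 h3 h4
    rw [h2, Pi.sub_apply, h1, hf, h3, hf1, h4]
    simp only [Set.indicator_univ, norm_one, mul_one]
    refine (norm_evalAt_sub_le hx ⟨hy.1.le, hy.2⟩ k).trans ?_
    refine mul_le_mul_of_nonneg_right (Real.sqrt_le_sqrt ?_) (norm_nonneg _)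
    rw [abs_le]
    constructor <;> linarith [hx.1, hx.2, hy.1, hy.2]
  rw [hf1, hnorm, norm_one, mul_one] at h1
  have h2 : (√ℓ * ‖k.2‖) * √ℓ = ℓ * ‖k.2‖ := by
    rw [mul_right_comm, Real.mul_self_sqrt hℓ.le]
  rw [h2] at h1
  have h3 := norm_le_norm_sub_add f (edgeEmbed ℓ k)
  rw [hf, hnorm, ← hf] at h3
  linarith

/-- The form `a ‖u'‖² + ∫ q |u|²` controls the norm of `H¹(0, ℓ)`, up to a multiple of `‖u‖²`: by
the Sobolev inequality the potential is of order `‖u‖ (‖u‖ + ‖u'‖)`. -/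
theorem exists_edge_coercive (hℓ : 0 < ℓ) {a : ℝ} (ha : 0 < a) {q : ℝ → ℂ}
    (hq : MemLp q 2 (lebesgueIoc ℓ)) : ∃ c d : ℝ, 0 ≤ c ∧ 0 < d ∧ ∀ k : EdgeSpace ℓ,
      d * (‖k.1‖ ^ 2 + ‖k.2‖ ^ 2) ≤
        a * ‖k.2‖ ^ 2 + RCLike.re ⟪edgeEmbed ℓ k, mulEval q hq k⟫_ℂ
          + c * ‖edgeEmbed ℓ k‖ ^ 2 := by
  have hs : 0 < √ℓ := Real.sqrt_pos.2 hℓ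
  set b := ‖hq.toLp q‖ / √ℓ with hb
  have hb0 : 0 ≤ b := by positivity
  -- half of the stiffness pays for the norm of `H¹`, the other half for the potential
  set d := a / 2 / (1 + 2 * ℓ) with hd
  have hd0 : 0 < d := by positivity
  refine ⟨b + (b * ℓ) ^ 2 / (2 * a) + d * (2 / ℓ), d, by positivity, hd0, fun k => ?_⟩
  set N := ‖edgeEmbed ℓ k‖ with hN
  set g := ‖k.2‖ with hg
  have hN0 : 0 ≤ N := norm_nonneg _
  have hg0 : 0 ≤ g := norm_nonneg _
  have hev : ∀ x ∈ Set.Icc 0 ℓ, ‖evalAt ℓ x k‖ ≤ (N + ℓ * g) / √ℓ := fun x hx => by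
    rw [le_div_iff₀ hs, mul_comm]
    exact sqrt_mul_norm_evalAt_le hℓ hx k
  have hQ : -(N * (b * (N + ℓ * g))) ≤ RCLike.re ⟪edgeEmbed ℓ k, mulEval q hq k⟫_ℂ := by
    refine (abs_le.1 ((RCLike.abs_re_le_norm _).trans ((norm_inner_le_norm _ _).trans ?_))).1
    refine mul_le_mul_of_nonneg_left ((norm_mulEval_le hq k hev).trans (le_of_eq ?_)) hN0
    rw [hb]; ring
  have hk1 : ‖k.1‖ ^ 2 ≤ 2 / ℓ * N ^ 2 + 2 * ℓ * g ^ 2 := by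
    have h0 := hev 0 ⟨le_rfl, hℓ.le⟩
    rw [evalAt_apply ⟨le_rfl, hℓ.le⟩, intervalIntegral.integral_same, add_zero] at h0
    calc ‖k.1‖ ^ 2 ≤ ((N + ℓ * g) / √ℓ) ^ 2 := by gcongr
      _ = (N + ℓ * g) ^ 2 / ℓ := by rw [div_pow, Real.sq_sqrt hℓ.le]
      _ ≤ (2 * N ^ 2 + 2 * (ℓ * g) ^ 2) / ℓ := by
          gcongr
          linarith [sq_nonneg (N - ℓ * g), add_sq N (ℓ * g), sub_sq N (ℓ * g)]
      _ = 2 / ℓ * N ^ 2 + 2 * ℓ * g ^ 2 := by field_simp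
  have hdg : d * (1 + 2 * ℓ) = a / 2 := by rw [hd]; field_simp
  have hdk := mul_le_mul_of_nonneg_left hk1 hd0.le
  -- Young's inequality for the mixed term `b ℓ N g`
  have hY : b * ℓ * N * g ≤ a / 2 * g ^ 2 + (b * ℓ) ^ 2 / (2 * a) * N ^ 2 := by
    have : a / 2 * g ^ 2 + (b * ℓ) ^ 2 / (2 * a) * N ^ 2 - b * ℓ * N * g =
        (a * g - b * ℓ * N) ^ 2 / (2 * a) := by field_simp; ring
    have : 0 ≤ (a * g - b * ℓ * N) ^ 2 / (2 * a) := by positivity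
    linarith
  have hdg2 : d * g ^ 2 + d * (2 * ℓ * g ^ 2) = a / 2 * g ^ 2 := by rw [← hdg]; ring
  nlinarith [hdk, hY, hQ, hdg2]

end Edge

/-! ### Integration by parts and density on an interval -/

section EdgeDuality

variable {ℓ : ℝ}

theorem intervalIntegral_conj (f : ℝ → ℂ) (a b : ℝ) :
    ∫ t in a..b, conj (f t) = conj (∫ t in a..b, f t) := by
  simp only [intervalIntegral.intervalIntegral_eq_integral_uIoc, integral_conj, Complex.real_smul,
    map_mul, Complex.conj_ofReal]

theorem evalAt_zero (hℓ : 0 ≤ ℓ) (k : EdgeSpace ℓ) : evalAt ℓ 0 k = k.1 := by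
  rw [evalAt_apply ⟨le_rfl, hℓ⟩, intervalIntegral.integral_same, add_zero]

/-- The constant function `1` in `L²(0, ℓ)`. -/
def edgeOne (ℓ : ℝ) : Lp ℂ 2 (lebesgueIoc ℓ) :=
  indicatorConstLp 2 (s := Set.Ioc 0 ℓ) measurableSet_Ioc (measure_ne_top _ _) (1 : ℂ)

theorem edgeOne_coeFn (ℓ : ℝ) : edgeOne ℓ =ᵐ[lebesgueIoc ℓ] fun _ => 1 := by
  filter_upwards [ae_mem_Ioc ℓ, indicatorConstLp_coeFn (p := 2) (μ := lebesgueIoc ℓ)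
    (hs := measurableSet_Ioc (a := (0 : ℝ)) (b := ℓ)) (hμs := measure_ne_top _ _) (c := (1 : ℂ))]
    with x hx h
  rw [edgeOne, h, Set.indicator_of_mem hx]

theorem evalAt_length (k : EdgeSpace ℓ) : evalAt ℓ ℓ k = k.1 + ⟪edgeOne ℓ, k.2⟫_ℂ := rfl

theorem memLp_tail (y : Lp ℂ 2 (lebesgueIoc ℓ)) :
    MemLp (fun t => ∫ x in t..ℓ, y x) 2 (lebesgueIoc ℓ) := by
  have h := (memLp_mul_evalAt (ℓ := ℓ) (m := 1) (memLp_const 1) (0, y))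
  refine ((memLp_const (evalAt ℓ ℓ (0, y))).sub h).ae_eq ?_
  filter_upwards [ae_mem_Ioc ℓ] with t ht
  have h0 : (0 : ℝ) ∈ Set.Icc 0 ℓ := ⟨le_rfl, ht.1.le.trans ht.2⟩
  have h1 : ℓ ∈ Set.Icc 0 ℓ := ⟨h0.2, le_rfl⟩
  have ht' : t ∈ Set.Icc 0 ℓ := ⟨ht.1.le, ht.2⟩
  rw [Pi.sub_apply, Pi.one_apply, one_mul, evalAt_apply ht', evalAt_apply h1,
    add_sub_add_left_eq_sub, intervalIntegral.integral_interval_sub_left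
      (Lp_intervalIntegrable _ h0 h1) (Lp_intervalIntegrable _ h0 ht')]

/-- The function `t ↦ ∫_t^ℓ y`. -/
def tail (y : Lp ℂ 2 (lebesgueIoc ℓ)) : Lp ℂ 2 (lebesgueIoc ℓ) := (memLp_tail y).toLp

theorem tail_coeFn (y : Lp ℂ 2 (lebesgueIoc ℓ)) :
    tail y =ᵐ[lebesgueIoc ℓ] fun t => ∫ x in t..ℓ, y x := (memLp_tail y).coeFn_toLp

theorem inner_Lp_eq_integral (f g : Lp ℂ 2 (lebesgueIoc ℓ)) :
    ⟪f, g⟫_ℂ = ∫ x, g x * conj (f x) ∂lebesgueIoc ℓ := by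
  rw [L2.inner_def]
  exact integral_congr_ae (.of_forall fun x => RCLike.inner_apply _ _)

/-- Integration by parts: the adjoint of the embedding of `H¹(0, ℓ)` into `L²(0, ℓ)`. -/
theorem inner_edgeEmbed (k : EdgeSpace ℓ) (y : Lp ℂ 2 (lebesgueIoc ℓ)) :
    ⟪edgeEmbed ℓ k, y⟫_ℂ = conj k.1 * (∫ x, y x ∂lebesgueIoc ℓ) + ⟪k.2, tail y⟫_ℂ := by
  have hy : Integrable y (lebesgueIoc ℓ) := (Lp.memLp y).integrable one_le_two
  have hk : Integrable k.2 (lebesgueIoc ℓ) := (Lp.memLp k.2).integrable one_le_two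
  have hk' : Integrable (fun t => conj (k.2 t)) (lebesgueIoc ℓ) :=
    (LinearIsometryEquiv.integrable_comp_iff Complex.conjLIE).2 hk
  have h1 : ⟪edgeEmbed ℓ k, y⟫_ℂ = ∫ x, (conj k.1 * y x +
      y x * ∫ t in (0 : ℝ)..x, conj (k.2 t)) ∂lebesgueIoc ℓ := by
    rw [inner_Lp_eq_integral]
    refine integral_congr_ae ?_
    filter_upwards [ae_mem_Ioc ℓ, edgeEmbed_coeFn k] with x hx h
    rw [h, evalAt_apply ⟨hx.1.le, hx.2⟩, map_add, intervalIntegral_conj]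
    ring
  have h2 : Integrable (fun x => y x * ∫ t in (0 : ℝ)..x, conj (k.2 t)) (lebesgueIoc ℓ) := by
    have h3 := (L2.integrable_inner (𝕜 := ℂ) (edgeEmbed ℓ (0, k.2)) y)
    refine h3.congr ?_
    filter_upwards [ae_mem_Ioc ℓ, edgeEmbed_coeFn ((0, k.2) : EdgeSpace ℓ)] with x hx h
    rw [h, evalAt_apply ⟨hx.1.le, hx.2⟩, RCLike.inner_apply, intervalIntegral_conj]
    simp
  rw [h1, integral_add (hy.const_mul _) h2, integral_const_mul, integral_mul_primitive hy hk',
    inner_Lp_eq_integral]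
  congr 1
  refine integral_congr_ae ?_
  filter_upwards [tail_coeFn y] with t ht
  rw [ht]

/-- `H¹(0, ℓ)` is dense in `L²(0, ℓ)`, since it contains the test functions. -/
theorem eq_zero_of_inner_edgeEmbed (y : Lp ℂ 2 (lebesgueIoc ℓ))
    (h : ∀ k, ⟪edgeEmbed ℓ k, y⟫_ℂ = 0) : y = 0 := by
  have hy : Integrable y (lebesgueIoc ℓ) := (Lp.memLp y).integrable one_le_two
  rw [Lp.eq_zero_iff_ae_eq_zero]
  refine ae_eq_zero_of_integral_contDiff_smul_eq_zero hy.locallyIntegrable fun φ hφ hφc => ?_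
  have hφ1 : ContDiff ℝ 1 φ := hφ.of_le (by simp)
  have hd : Continuous fun x => ((deriv φ x : ℝ) : ℂ) :=
    Complex.continuous_ofReal.comp (hφ1.continuous_deriv le_rfl)
  have hdc : HasCompactSupport fun x => ((deriv φ x : ℝ) : ℂ) :=
    hφc.deriv.comp_left Complex.ofReal_zero
  have hdm : MemLp (fun x => ((deriv φ x : ℝ) : ℂ)) 2 (lebesgueIoc ℓ) :=
    hd.memLp_of_hasCompactSupport hdc
  rw [← h ((φ 0 : ℂ), hdm.toLp), inner_Lp_eq_integral]
  refine integral_congr_ae ?_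
  filter_upwards [ae_mem_Ioc ℓ, edgeEmbed_coeFn (((φ 0 : ℂ), hdm.toLp) : EdgeSpace ℓ)] with x hx hk
  have h1 : ∫ t in (0 : ℝ)..x, hdm.toLp (fun x => ((deriv φ x : ℝ) : ℂ)) t =
      ∫ t in (0 : ℝ)..x, ((deriv φ t : ℝ) : ℂ) := by
    rw [intervalIntegral.integral_of_le hx.1.le, intervalIntegral.integral_of_le hx.1.le]
    exact integral_congr_ae (ae_restrict_of_ae_restrict_of_subset
      (Set.Ioc_subset_Ioc_right hx.2) hdm.coeFn_toLp)
  have h2 : ∫ t in (0 : ℝ)..x, deriv φ t = φ x - φ 0 :=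
    intervalIntegral.integral_deriv_eq_sub
      (fun t _ => (hφ1.differentiable one_ne_zero).differentiableAt)
      ((hφ1.continuous_deriv le_rfl).intervalIntegrable _ _)
  rw [hk, evalAt_apply ⟨hx.1.le, hx.2⟩, h1, intervalIntegral.integral_ofReal, h2]
  simp [mul_comm]

end EdgeDuality

/-! ### The form domain as a Hilbert space -/

namespace SemirigidGraph

variable {V E : Type*} (G : SemirigidGraph V E)

theorem q_memLp_ofReal (e : E) : MemLp (fun x => (G.q e x : ℂ)) 2 (lebesgueIoc (G.len e)) :=
  (G.q_memLp e).ofReal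

variable [Fintype V]

/-- The form domain as a Hilbert space: an element `(u, u°)` is given by the derivatives `u_e'` and
the vertex values `u_v°`, which form an element of `L²(G)`, and by the values `u_e 0`. -/
abbrev FormSpace : Type _ := WithLp 2 (G.L2 × EuclideanSpace ℂ E)

/-- The restriction of `(u, u°)` to the edge `e`. -/
def edgePart (e : E) : G.FormSpace →L[ℂ] EdgeSpace (G.len e) :=
  ((EuclideanSpace.proj e : EuclideanSpace ℂ E →L[ℂ] ℂ).comp (WithLp.sndL 2 ℂ _ _)).prod
    ((PiLp.proj 2 (fun e : E => Lp ℂ 2 (G.edgeMeasure e)) e).comp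
      ((WithLp.fstL 2 ℂ _ _).comp (WithLp.fstL 2 ℂ _ _)))

/-- The vertex values of `(u, u°)`. -/
def vertexPart : G.FormSpace →L[ℂ] G.VertexSpace :=
  (WithLp.sndL 2 ℂ _ _).comp (WithLp.fstL 2 ℂ _ _)

/-- The value at a vertex. -/
def vertexEval (v : V) : G.VertexSpace →L[ℂ] ℂ :=
  LinearMap.toContinuousLinearMap
    { toFun := fun c => c v, map_add' := fun _ _ => rfl, map_smul' := fun _ _ => rfl }

/-- The embedding of the form domain into `L²(G)`. -/
def formEmbed : G.FormSpace →L[ℂ] G.L2 :=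
  ((WithLp.prodContinuousLinearEquiv 2 ℂ (PiLp 2 fun e : E => Lp ℂ 2 (G.edgeMeasure e))
    G.VertexSpace).symm : _ →L[ℂ] G.L2).comp
    ((((PiLp.continuousLinearEquiv 2 ℂ fun e : E => Lp ℂ 2 (G.edgeMeasure e)).symm :
      _ →L[ℂ] PiLp 2 fun e : E => Lp ℂ 2 (G.edgeMeasure e)).comp
        (ContinuousLinearMap.pi fun e => (edgeEmbed (G.len e)).comp (G.edgePart e))).prod
      G.vertexPart)

/-- The element of the form domain with given parts on the edges and at the vertices. -/
def formMk (k : ∀ e, EdgeSpace (G.len e)) (c : G.VertexSpace) : G.FormSpace :=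
  WithLp.toLp 2 (WithLp.toLp 2 (WithLp.toLp 2 fun e => (k e).2, c), WithLp.toLp 2 fun e => (k e).1)

theorem edgePart_formMk (k : ∀ e, EdgeSpace (G.len e)) (c : G.VertexSpace) (e : E) :
    G.edgePart e (G.formMk k c) = k e := rfl

theorem vertexPart_formMk (k : ∀ e, EdgeSpace (G.len e)) (c : G.VertexSpace) :
    G.vertexPart (G.formMk k c) = c := rfl

theorem formMk_parts (k : G.FormSpace) :
    G.formMk (fun e => G.edgePart e k) (G.vertexPart k) = k := rfl

/-- The jump `u_v° - u_e(v)` at an edge end. -/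
def jumpMap (p : E × Bool) : G.FormSpace →L[ℂ] ℂ :=
  (G.vertexEval (G.endVertex p)).comp G.vertexPart -
    (evalAt (G.len p.1) (G.endCoord p)).comp (G.edgePart p.1)

/-- The product `q_e u_e`. -/
def potentialMap (e : E) : G.FormSpace →L[ℂ] Lp ℂ 2 (lebesgueIoc (G.len e)) :=
  (mulEval (fun x => (G.q e x : ℂ)) (G.q_memLp_ofReal e)).comp (G.edgePart e)

/-- The derivative `u_e'`. -/
def derivMap (e : E) : G.FormSpace →L[ℂ] Lp ℂ 2 (lebesgueIoc (G.len e)) :=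
  (ContinuousLinearMap.snd ℂ _ _).comp (G.edgePart e)

/-- The function `u_e`, as an element of `L²`. -/
def valueMap (e : E) : G.FormSpace →L[ℂ] Lp ℂ 2 (lebesgueIoc (G.len e)) :=
  (edgeEmbed (G.len e)).comp (G.edgePart e)

/-- The potential term is symmetric, as the potential is real. -/
theorem inner_valueMap_potentialMap (e : E) (w k : G.FormSpace) :
    ⟪G.valueMap e w, G.potentialMap e k⟫_ℂ = ⟪G.potentialMap e w, G.valueMap e k⟫_ℂ := by
  rw [inner_Lp_eq_integral, inner_Lp_eq_integral]
  refine integral_congr_ae ?_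
  filter_upwards [edgeEmbed_coeFn (G.edgePart e w), edgeEmbed_coeFn (G.edgePart e k),
    mulEval_coeFn (G.q_memLp_ofReal e) (G.edgePart e w),
    mulEval_coeFn (G.q_memLp_ofReal e) (G.edgePart e k)] with x h1 h2 h3 h4
  simp only [valueMap, potentialMap, ContinuousLinearMap.comp_apply, h1, h2, h3, h4, map_mul,
    Complex.conj_ofReal]
  ring

variable [Fintype E]

/-- The bounded operator `T` on the form domain with `h(u, w) = ⟪w, T u⟫`. -/
def formOperator : G.FormSpace →L[ℂ] G.FormSpace :=
  (∑ e, ((G.a : ℂ) • (G.derivMap e).adjoint.comp (G.derivMap e) +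
      (G.valueMap e).adjoint.comp (G.potentialMap e))) +
    ∑ p, (G.kappa : ℂ) • (G.jumpMap p).adjoint.comp (G.jumpMap p)

theorem inner_formOperator (w k : G.FormSpace) :
    ⟪w, G.formOperator k⟫_ℂ =
      (∑ e, ((G.a : ℂ) * ⟪G.derivMap e w, G.derivMap e k⟫_ℂ +
        ⟪G.valueMap e w, G.potentialMap e k⟫_ℂ)) +
      ∑ p, (G.kappa : ℂ) * (G.jumpMap p k * conj (G.jumpMap p w)) := by
  simp only [formOperator, add_apply, sum_apply, smul_apply, ContinuousLinearMap.comp_apply,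
    inner_add_right, inner_sum, inner_smul_right, ContinuousLinearMap.adjoint_inner_right,
    RCLike.inner_apply]

theorem formOperator_symm (w k : G.FormSpace) :
    ⟪G.formOperator w, k⟫_ℂ = ⟪w, G.formOperator k⟫_ℂ := by
  rw [← inner_conj_symm, inner_formOperator, inner_formOperator]
  simp only [map_add, map_sum, map_mul, Complex.conj_ofReal, inner_conj_symm, Complex.conj_conj]
  congr 1
  · refine Finset.sum_congr rfl fun e _ => ?_
    rw [G.inner_valueMap_potentialMap e w k]
  · exact Finset.sum_congr rfl fun p _ => by ring

theorem inner_formEmbed (k : G.FormSpace) (y : G.L2) : ⟪G.formEmbed k, y⟫_ℂ =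
    (∑ e, ⟪edgeEmbed (G.len e) (G.edgePart e k), y.fst e⟫_ℂ) + ⟪G.vertexPart k, y.snd⟫_ℂ := by
  rw [WithLp.prod_inner_apply, PiLp.inner_apply]; rfl

theorem norm_formEmbed_sq (k : G.FormSpace) : ‖G.formEmbed k‖ ^ 2 =
    (∑ e, ‖edgeEmbed (G.len e) (G.edgePart e k)‖ ^ 2) + ‖G.vertexPart k‖ ^ 2 := by
  rw [WithLp.prod_norm_sq_eq_of_L2, PiLp.norm_sq_eq_of_L2]; rfl

theorem norm_formSpace_sq (k : G.FormSpace) : ‖k‖ ^ 2 =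
    (∑ e, (‖(G.edgePart e k).1‖ ^ 2 + ‖(G.edgePart e k).2‖ ^ 2)) + ‖G.vertexPart k‖ ^ 2 := by
  rw [WithLp.prod_norm_sq_eq_of_L2, WithLp.prod_norm_sq_eq_of_L2, PiLp.norm_sq_eq_of_L2,
    PiLp.norm_sq_eq_of_L2, Finset.sum_add_distrib, add_right_comm,
    add_comm (∑ e, ‖(G.edgePart e k).1‖ ^ 2)]
  rfl

/-- The energy form is coercive on the form domain relative to `L²(G)`: up to a
multiple of the norm of `L²(G)`, it controls the norm of the form domain. -/
theorem exists_form_coercive : ∃ c d : ℝ, 0 < d ∧ ∀ k : G.FormSpace,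
    d * ‖k‖ ^ 2 ≤ RCLike.re ⟪k, G.formOperator k⟫_ℂ + c * ‖G.formEmbed k‖ ^ 2 := by
  choose c d hc hd h using fun e => exists_edge_coercive (G.len_pos e) G.a_pos (G.q_memLp_ofReal e)
  obtain ⟨d₀, hd₀, hd₀1, hd₀d⟩ : ∃ d₀ : ℝ, 0 < d₀ ∧ d₀ ≤ 1 ∧ ∀ e, d₀ ≤ d e := by
    rcases isEmpty_or_nonempty E with hE | hE
    · exact ⟨1, one_pos, le_rfl, fun e => isEmptyElim e⟩
    · obtain ⟨e₀, he₀⟩ := Finite.exists_min d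
      exact ⟨min 1 (d e₀), lt_min one_pos (hd e₀), min_le_left _ _,
        fun e => (min_le_right _ _).trans (he₀ e)⟩
  have hcs : ∀ e, c e ≤ 1 + ∑ e, c e := fun e =>
    (Finset.single_le_sum (fun i _ => hc i) (Finset.mem_univ e)).trans (by linarith)
  refine ⟨1 + ∑ e, c e, d₀, hd₀, fun k => ?_⟩
  have hsum : 0 ≤ ∑ e, c e := Finset.sum_nonneg fun e _ => hc e
  have hform : RCLike.re ⟪k, G.formOperator k⟫_ℂ =
      (∑ e, (G.a * ‖(G.edgePart e k).2‖ ^ 2 + RCLike.re ⟪G.valueMap e k, G.potentialMap e k⟫_ℂ)) +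
        ∑ p, G.kappa * ‖G.jumpMap p k‖ ^ 2 := by
    rw [inner_formOperator]
    simp only [map_add, map_sum, Complex.mul_conj, Complex.normSq_eq_norm_sq,
      inner_self_eq_norm_sq_to_K, RCLike.re_to_complex, ← Complex.ofReal_mul, Complex.ofReal_re]
    congr 1
    refine Finset.sum_congr rfl fun e _ => ?_
    congr 1
    rw [← RCLike.ofReal_pow]
    exact Complex.re_ofReal_mul _ _
  rw [hform, norm_formEmbed_sq, norm_formSpace_sq, mul_add, mul_add, Finset.mul_sum,
    Finset.mul_sum]
  have hjump : 0 ≤ ∑ p, G.kappa * ‖G.jumpMap p k‖ ^ 2 :=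
    Finset.sum_nonneg fun p _ => mul_nonneg G.kappa_pos.le (sq_nonneg _)
  have hv : d₀ * ‖G.vertexPart k‖ ^ 2 ≤ (1 + ∑ e, c e) * ‖G.vertexPart k‖ ^ 2 :=
    mul_le_mul_of_nonneg_right (by linarith) (sq_nonneg _)
  have he : ∑ e, d₀ * (‖(G.edgePart e k).1‖ ^ 2 + ‖(G.edgePart e k).2‖ ^ 2) ≤
      ∑ e, ((G.a * ‖(G.edgePart e k).2‖ ^ 2 +
        RCLike.re ⟪G.valueMap e k, G.potentialMap e k⟫_ℂ) +
          (1 + ∑ e, c e) * ‖edgeEmbed (G.len e) (G.edgePart e k)‖ ^ 2) :=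
    Finset.sum_le_sum fun e _ =>
      (mul_le_mul_of_nonneg_right (hd₀d e) (by positivity)).trans ((h e (G.edgePart e k)).trans
        (add_le_add le_rfl (mul_le_mul_of_nonneg_right (hcs e) (sq_nonneg _))))
  rw [Finset.sum_add_distrib] at he
  linarith

theorem isCompactOperator_formEmbed : IsCompactOperator G.formEmbed := by
  choose C hC hC' using fun e => (isCompactOperator_mulEval (G.len_pos e)
    (m := 1) (memLp_const 1)).comp_clm (G.edgePart e)
  obtain ⟨D, hD, hD'⟩ : IsCompactOperator G.vertexPart :=
    haveI : ProperSpace G.VertexSpace := FiniteDimensional.proper ℂ _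
    isCompactOperator_of_locallyCompactSpace_dom G.vertexPart
  refine IsCompactOperator.continuous_comp (f := fun k =>
    ((fun e => edgeEmbed (G.len e) (G.edgePart e k)), G.vertexPart k))
    (g := fun z => (WithLp.toLp 2 (WithLp.toLp 2 z.1, z.2) : G.L2)) ?_ ?_
  · refine ⟨(Set.univ.pi C) ×ˢ D, (isCompact_univ_pi hC).prod hD, ?_⟩
    filter_upwards [(Filter.eventually_all (ι := E)).2 fun e => hC' e, hD'] with k h1 h2
    exact ⟨fun e _ => h1 e, h2⟩
  · exact (WithLp.prod_continuous_toLp 2 _ _).comp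
      (((PiLp.continuous_toLp 2 _).comp continuous_fst).prodMk continuous_snd)

/-- The form domain is dense in `L²(G)`. -/
theorem eq_zero_of_inner_formEmbed (y : G.L2) (h : ∀ k, ⟪G.formEmbed k, y⟫_ℂ = 0) : y = 0 := by
  classical
  have h1 : ∀ e, y.fst e = 0 := fun e => by
    refine eq_zero_of_inner_edgeEmbed _ fun k => ?_
    have := h (G.formMk (Pi.single e k) 0)
    rw [inner_formEmbed, vertexPart_formMk, inner_zero_left, add_zero,
      Finset.sum_eq_single_of_mem e (Finset.mem_univ e), edgePart_formMk, Pi.single_eq_same] at this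
    · exact this
    · intro e' _ he
      rw [edgePart_formMk, Pi.single_eq_of_ne he, map_zero, inner_zero_left]
  have h2 : y.snd = 0 := by
    have := h (G.formMk 0 y.snd)
    rw [inner_formEmbed, vertexPart_formMk, Finset.sum_eq_zero, zero_add] at this
    · exact inner_self_eq_zero.1 this
    · intro e _
      rw [edgePart_formMk, Pi.zero_apply, map_zero, inner_zero_left]
  have h3 : y.fst = 0 := by ext1 e; exact h1 e
  rw [WithLp.ext_iff]
  exact Prod.ext h3 h2

end SemirigidGraph

/-! ### The Euler–Lagrange equations of the energy -/

namespace SemirigidGraph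

variable {V E : Type*} (G : SemirigidGraph V E)

section Coordinates

variable {G}

theorem endCoord_mem (p : E × Bool) : G.endCoord p ∈ Set.Icc 0 (G.len p.1) := by
  have := (G.len_pos p.1).le
  unfold endCoord
  split_ifs
  exacts [⟨this, le_rfl⟩, ⟨le_rfl, this⟩]

variable [Fintype V]

/-- The element of the Hilbert space `FormSpace` given by an element of `∏_e H¹(e) × ∏_v ℂ`. -/
def H1.toForm (u : G.H1) : G.FormSpace :=
  G.formMk (fun e => (u.val e 0, (u.der_memLp e).toLp (u.der e))) u.vert

theorem H1.evalAt_toForm (u : G.H1) (e : E) {x : ℝ} (hx : x ∈ Set.Icc 0 (G.len e)) :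
    evalAt (G.len e) x (G.edgePart e u.toForm) = u.val e x := by
  rw [evalAt_apply hx, u.val_eq e x hx, intervalIntegral.integral_of_le hx.1,
    intervalIntegral.integral_of_le hx.1]
  congr 1
  exact integral_congr_ae (ae_restrict_of_ae_restrict_of_subset
    (Set.Ioc_subset_Ioc_right hx.2) (u.der_memLp e).coeFn_toLp)

theorem H1.jumpMap_toForm (u : G.H1) (p : E × Bool) : G.jumpMap p u.toForm = u.jump p := by
  rw [H1.jump, ← u.evalAt_toForm p.1 (endCoord_mem p)]; rfl

theorem H1.valueMap_toForm (u : G.H1) (e : E) :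
    G.valueMap e u.toForm = (u.val_memLp e).toLp (u.val e) := by
  ext1
  filter_upwards [ae_mem_Ioc (G.len e), edgeEmbed_coeFn (G.edgePart e u.toForm),
    (u.val_memLp e).coeFn_toLp] with x hx h1 h2
  rw [h2, valueMap, ContinuousLinearMap.comp_apply, h1, u.evalAt_toForm e ⟨hx.1.le, hx.2⟩]

theorem H1.potentialMap_toForm (u : G.H1) (e : E) :
    G.potentialMap e u.toForm =ᵐ[lebesgueIoc (G.len e)] fun x => (G.q e x : ℂ) * u.val e x := by
  filter_upwards [ae_mem_Ioc (G.len e),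
    mulEval_coeFn (G.q_memLp_ofReal e) (G.edgePart e u.toForm)] with x hx h1
  rw [potentialMap, ContinuousLinearMap.comp_apply, h1, u.evalAt_toForm e ⟨hx.1.le, hx.2⟩]

theorem H1.derivMap_toForm (u : G.H1) (e : E) :
    G.derivMap e u.toForm =ᵐ[lebesgueIoc (G.len e)] u.der e :=
  (u.der_memLp e).coeFn_toLp

theorem H1.formEmbed_toForm (u : G.H1) : G.formEmbed u.toForm = u.toL2 := by
  rw [WithLp.ext_iff]
  refine Prod.ext ?_ rfl
  ext1 e
  exact u.valueMap_toForm e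

theorem H1.exists_toForm_eq (k : G.FormSpace) : ∃ u : G.H1, u.toForm = k := by
  refine ⟨{ val := fun e x => (G.edgePart e k).1 + ∫ t in (0 : ℝ)..x, (G.edgePart e k).2 t
            der := fun e => (G.edgePart e k).2
            vert := G.vertexPart k
            der_memLp := fun e => Lp.memLp (G.edgePart e k).2
            val_eq := fun e x _ => by rw [intervalIntegral.integral_same, add_zero] }, ?_⟩
  rw [H1.toForm]
  conv_rhs => rw [← G.formMk_parts k]
  congr 1
  funext e
  exact Prod.ext (by simp) (Lp.toLp_coeFn _ (Lp.memLp _))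

variable [Fintype E] [DecidableEq V]

theorem sum_sum_endsAt {M : Type*} [AddCommMonoid M] (f : E × Bool → M) :
    ∑ v, ∑ p ∈ G.endsAt v, f p = ∑ p, f p :=
  Finset.sum_fiberwise _ _ _

theorem energyForm_eq_inner (u w : G.H1) :
    energyForm u w = ⟪w.toForm, G.formOperator u.toForm⟫_ℂ := by
  rw [energyForm, inner_formOperator, sum_sum_endsAt]
  congr 1
  · refine Finset.sum_congr rfl fun e _ => ?_
    have i1 := (L2.integrable_inner (𝕜 := ℂ) (G.derivMap e w.toForm)
      (G.derivMap e u.toForm)).const_mul (G.a : ℂ)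
    have i2 := L2.integrable_inner (𝕜 := ℂ) (G.valueMap e w.toForm) (G.potentialMap e u.toForm)
    rw [intervalIntegral.integral_of_le (G.len_pos e).le, L2.inner_def, L2.inner_def,
      ← integral_const_mul, ← integral_add i1 i2]
    refine integral_congr_ae ?_
    rw [w.valueMap_toForm e]
    filter_upwards [u.derivMap_toForm e, w.derivMap_toForm e, u.potentialMap_toForm e,
      (w.val_memLp e).coeFn_toLp] with x h1 h2 h3 h4
    rw [h1, h2, h3, h4, RCLike.inner_apply, RCLike.inner_apply, mul_assoc]
  · refine Finset.sum_congr rfl fun p _ => ?_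
    rw [u.jumpMap_toForm, w.jumpMap_toForm]

end Coordinates

section EulerLagrange

/-- The indicator of a vertex. -/
def vertexSingle [DecidableEq V] (v : V) : G.VertexSpace := (Pi.single v 1 : V → ℂ)

variable [Fintype V]

theorem vertexEval_vertexSingle [DecidableEq V] (v v' : V) :
    G.vertexEval v' (G.vertexSingle v) = if v' = v then 1 else 0 :=
  Pi.single_apply (M := ℂ) v 1 v'

theorem conj_jumpMap (w : G.FormSpace) (e : E) (b : Bool) :
    conj (G.jumpMap (e, b) w) = conj (G.vertexEval (G.endVertex (e, b)) (G.vertexPart w)) -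
      (conj (G.edgePart e w).1 +
        if b then ⟪(G.edgePart e w).2, edgeOne (G.len e)⟫_ℂ else 0) := by
  cases b
  · simp [jumpMap, endCoord, evalAt_zero (G.len_pos e).le]
  · simp [jumpMap, endCoord, evalAt_length, inner_conj_symm]

variable [Fintype E] [DecidableEq V]

/-- The defect of the weak equation `h(k, w) = ⟪w, y⟫`, integrated by parts so that it is a linear
functional of the coordinates `w_e 0`, `w_e'` and `w_v°` of the test element. -/
theorem inner_formOperator_sub_inner_formEmbed (w k : G.FormSpace) (y : G.L2) :
    ⟪w, G.formOperator k⟫_ℂ - ⟪G.formEmbed w, y⟫_ℂ =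
      (∑ e, (⟪(G.edgePart e w).2, (G.a : ℂ) • G.derivMap e k +
            tail (G.potentialMap e k - y.fst e) -
            ((G.kappa : ℂ) * G.jumpMap (e, true) k) • edgeOne (G.len e)⟫_ℂ +
          conj (G.edgePart e w).1 *
            ((∫ x, (G.potentialMap e k - y.fst e) x ∂lebesgueIoc (G.len e)) -
              (G.kappa : ℂ) * (G.jumpMap (e, true) k + G.jumpMap (e, false) k)))) +
        ∑ v, conj (G.vertexEval v (G.vertexPart w)) *
          ((∑ p ∈ G.endsAt v, (G.kappa : ℂ) * G.jumpMap p k) -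
            (G.mass v : ℂ) * G.vertexEval v y.snd) := by
  have h1 : ∀ e, ⟪G.valueMap e w, G.potentialMap e k⟫_ℂ -
      ⟪edgeEmbed (G.len e) (G.edgePart e w), y.fst e⟫_ℂ =
      conj (G.edgePart e w).1 * (∫ x, (G.potentialMap e k - y.fst e) x ∂lebesgueIoc (G.len e)) +
        ⟪(G.edgePart e w).2, tail (G.potentialMap e k - y.fst e)⟫_ℂ := fun e => by
    rw [← inner_edgeEmbed, inner_sub_right]; rfl
  have h2 : ∑ p, (G.kappa : ℂ) * (G.jumpMap p k * conj (G.jumpMap p w)) =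
      (∑ v, conj (G.vertexEval v (G.vertexPart w)) *
        (∑ p ∈ G.endsAt v, (G.kappa : ℂ) * G.jumpMap p k)) -
      ∑ e, ((G.kappa : ℂ) * G.jumpMap (e, true) k * ⟪(G.edgePart e w).2, edgeOne (G.len e)⟫_ℂ +
        conj (G.edgePart e w).1 *
          ((G.kappa : ℂ) * (G.jumpMap (e, true) k + G.jumpMap (e, false) k))) := by
    have h3 : ∑ v, conj (G.vertexEval v (G.vertexPart w)) *
        (∑ p ∈ G.endsAt v, (G.kappa : ℂ) * G.jumpMap p k) =
        ∑ p, conj (G.vertexEval (G.endVertex p) (G.vertexPart w)) *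
          ((G.kappa : ℂ) * G.jumpMap p k) := by
      rw [← sum_sum_endsAt (G := G)]
      refine Finset.sum_congr rfl fun v _ => ?_
      rw [Finset.mul_sum]
      refine Finset.sum_congr rfl fun p hp => ?_
      rw [(Finset.mem_filter.1 hp).2]
    rw [h3, Fintype.sum_prod_type, Fintype.sum_prod_type, ← Finset.sum_sub_distrib]
    refine Finset.sum_congr rfl fun e _ => ?_
    simp only [Fintype.sum_bool, conj_jumpMap, if_true, Bool.false_eq_true, if_false]
    ring
  have h4 : ⟪G.vertexPart w, y.snd⟫_ℂ =
      ∑ v, conj (G.vertexEval v (G.vertexPart w)) * ((G.mass v : ℂ) * G.vertexEval v y.snd) := by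
    rw [vertexSpace_inner]
    exact Finset.sum_congr rfl fun v _ => mul_left_comm _ _ _
  simp only [mul_sub, Finset.sum_sub_distrib (s := (Finset.univ : Finset V))]
  rw [inner_formOperator, inner_formEmbed, h2, h4]
  have h5 : ∀ A B C D F I : ℂ, A + (B - C) - (D + F) = (A - D - C) + (B - F) := by
    intros; ring
  rw [h5 _ _ _ _ _ 0, ← Finset.sum_sub_distrib, ← Finset.sum_sub_distrib]
  congr 1
  refine Finset.sum_congr rfl fun e _ => ?_
  rw [add_sub_assoc, h1, inner_sub_right, inner_add_right, inner_smul_right, inner_smul_right]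
  change _ * ⟪(G.edgePart e w).2, (G.edgePart e k).2⟫_ℂ + _ - _ =
    _ * ⟪(G.edgePart e w).2, (G.edgePart e k).2⟫_ℂ + _ - _ + _
  ring

/-- The Euler–Lagrange equations of the energy form: the equation on each edge, integrated from the
terminus, the balance of forces on each edge, and the balance of forces at each vertex. -/
theorem formOperator_eq_iff (k : G.FormSpace) (y : G.L2) :
    (∀ w, ⟪w, G.formOperator k⟫_ℂ = ⟪G.formEmbed w, y⟫_ℂ) ↔
      (∀ e, (G.a : ℂ) • G.derivMap e k + tail (G.potentialMap e k - y.fst e) =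
          ((G.kappa : ℂ) * G.jumpMap (e, true) k) • edgeOne (G.len e) ∧
        ∫ x, (G.potentialMap e k - y.fst e) x ∂lebesgueIoc (G.len e) =
          (G.kappa : ℂ) * (G.jumpMap (e, true) k + G.jumpMap (e, false) k)) ∧
      ∀ v, ∑ p ∈ G.endsAt v, (G.kappa : ℂ) * G.jumpMap p k =
        (G.mass v : ℂ) * G.vertexEval v y.snd := by
  classical
  constructor
  · intro h
    have h0 : ∀ w, ⟪w, G.formOperator k⟫_ℂ - ⟪G.formEmbed w, y⟫_ℂ = 0 := fun w =>
      sub_eq_zero.2 (h w)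
    simp only [inner_formOperator_sub_inner_formEmbed] at h0
    refine ⟨fun e => ?_, fun v => ?_⟩
    · have h1 : ∀ x : EdgeSpace (G.len e), _ := fun x => h0 (G.formMk (Pi.single e x) 0)
      simp only [edgePart_formMk, vertexPart_formMk, map_zero, zero_mul, Finset.sum_const_zero,
        add_zero] at h1
      have h2 : ∀ x : EdgeSpace (G.len e), ⟪x.2, (G.a : ℂ) • G.derivMap e k +
            tail (G.potentialMap e k - y.fst e) -
            ((G.kappa : ℂ) * G.jumpMap (e, true) k) • edgeOne (G.len e)⟫_ℂ +
          conj x.1 * ((∫ x, (G.potentialMap e k - y.fst e) x ∂lebesgueIoc (G.len e)) -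
              (G.kappa : ℂ) * (G.jumpMap (e, true) k + G.jumpMap (e, false) k)) = 0 := fun x => by
        have := h1 x
        rw [Finset.sum_eq_single_of_mem e (Finset.mem_univ e), Pi.single_eq_same] at this
        · exact this
        · intro e' _ he
          rw [Pi.single_eq_of_ne he, Prod.fst_zero, Prod.snd_zero, inner_zero_left, map_zero,
            zero_mul, add_zero]
      constructor
      · rw [← sub_eq_zero]
        refine ext_inner_left ℂ fun g => ?_
        simpa using h2 (0, g)
      · rw [← sub_eq_zero]
        simpa using h2 (1, 0)
    · have h1 := h0 (G.formMk 0 (G.vertexSingle v))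
      simpa [edgePart_formMk, vertexPart_formMk, vertexEval_vertexSingle, sub_eq_zero] using h1
  · rintro ⟨he, hv⟩ w
    rw [← sub_eq_zero, inner_formOperator_sub_inner_formEmbed, Finset.sum_eq_zero,
      Finset.sum_eq_zero, add_zero]
    · intro v _
      rw [hv, sub_self, mul_zero]
    · intro e _
      rw [(he e).1, (he e).2, sub_self, sub_self, inner_zero_right, mul_zero, add_zero]

end EulerLagrange

end SemirigidGraph

/-! ### The domain of the operator -/

namespace SemirigidGraph

variable {V E : Type*} {G : SemirigidGraph V E}

/-- The semi-rigidity conditions say that the outward force at each edge end is `κ` times the jump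
there. -/
theorem H2.semirigid_iff [Fintype E] [DecidableEq V] (u : G.H2) : u.IsSemirigid ↔
    ∀ e, (G.a : ℂ) * u.der e (G.len e) = (G.kappa : ℂ) * u.jump (e, true) ∧
      -((G.a : ℂ) * u.der e 0) = (G.kappa : ℂ) * u.jump (e, false) := by
  have hκ : (G.kappa : ℂ) ≠ 0 := Complex.ofReal_ne_zero.2 G.kappa_pos.ne'
  have h : u.IsSemirigid ↔ ∀ p : E × Bool, ((endSign p * G.a : ℝ) : ℂ) *
      u.der p.1 (G.endCoord p) = (G.kappa : ℂ) * u.jump p := by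
    have h1 : ∀ p : E × Bool, u.val p.1 (G.endCoord p) +
        ((endSign p * G.a * G.kappa⁻¹ : ℝ) : ℂ) * u.der p.1 (G.endCoord p) =
          u.vert (G.endVertex p) ↔
        ((endSign p * G.a : ℝ) : ℂ) * u.der p.1 (G.endCoord p) = (G.kappa : ℂ) * u.jump p :=
      fun p => by
        rw [H1.jump, ← inv_mul_eq_iff_eq_mul₀ hκ, eq_sub_iff_add_eq',
          Complex.ofReal_mul _ G.kappa⁻¹, Complex.ofReal_inv, mul_comm _ (G.kappa : ℂ)⁻¹, mul_assoc]
    simp only [H2.IsSemirigid, endsAt, Finset.mem_filter, Finset.mem_univ, true_and, ← h1]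
    exact ⟨fun hu p => hu _ p rfl, fun hu v p hp => hp ▸ hu p⟩
  rw [h, Prod.forall]
  refine forall_congr' fun e => ?_
  simp [Bool.forall_bool, endSign, endCoord, and_comm]

theorem H2.integral_der2 (u : G.H2) (e : E) {x : ℝ} (hx : x ∈ Set.Icc 0 (G.len e)) :
    ∫ t in x..G.len e, u.der2 e t = u.der e (G.len e) - u.der e x := by
  have hi : ∀ x ∈ Set.Icc 0 (G.len e), IntervalIntegrable (u.der2 e) volume 0 x := fun x hx => by
    rw [intervalIntegrable_iff_integrableOn_Ioc_of_le hx.1]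
    have h : IntegrableOn (u.der2 e) (Set.Ioc 0 (G.len e)) :=
      (u.der2_memLp e).integrable one_le_two
    exact h.mono_set (Set.Ioc_subset_Ioc_right hx.2)
  have hl : G.len e ∈ Set.Icc 0 (G.len e) := ⟨(G.len_pos e).le, le_rfl⟩
  rw [u.der_eq e _ hl, u.der_eq e x hx, add_sub_add_left_eq_sub,
    intervalIntegral.integral_interval_sub_left (hi _ hl) (hi x hx)]

theorem H2.memLp_image (u : G.H2) (e : E) : MemLp (fun x => -(G.a : ℂ) * u.der2 e x +
    (G.q e x : ℂ) * u.val e x) 2 (lebesgueIoc (G.len e)) := by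
  have h : MemLp (fun x => (G.q e x : ℂ) * u.val e x) 2 (lebesgueIoc (G.len e)) := by
    have h0 := memLp_mul_evalAt (G.q_memLp_ofReal e)
      ((u.val e 0, (u.der_memLp e).toLp (u.der e)) : EdgeSpace (G.len e))
    refine h0.ae_eq ?_
    filter_upwards [ae_mem_Ioc (G.len e)] with x hx
    have hx' : x ∈ Set.Icc 0 (G.len e) := ⟨hx.1.le, hx.2⟩
    rw [evalAt_apply hx', u.val_eq e x hx', intervalIntegral.integral_of_le hx.1.le,
      intervalIntegral.integral_of_le hx.1.le]
    congr 2
    exact integral_congr_ae (ae_restrict_of_ae_restrict_of_subset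
      (Set.Ioc_subset_Ioc_right hx.2) (u.der_memLp e).coeFn_toLp)
  exact ((u.der2_memLp e).const_mul _).add h

/-- The image of `(u, u°)` under the differential operator. -/
def H2.image [Fintype E] [DecidableEq V] (u : G.H2) : G.L2 :=
  WithLp.toLp 2 (WithLp.toLp 2 fun e => (u.memLp_image e).toLp,
    fun v => (G.mass v : ℂ)⁻¹ * u.netForce v)

variable [Fintype V]

theorem H2.potentialMap_sub_image [Fintype E] [DecidableEq V] (u : G.H2) (e : E) :
    (G.potentialMap e u.toForm - u.image.fst e : Lp ℂ 2 (lebesgueIoc (G.len e)))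
      =ᵐ[lebesgueIoc (G.len e)] fun x => (G.a : ℂ) * u.der2 e x := by
  filter_upwards [Lp.coeFn_sub (G.potentialMap e u.toForm) (u.image.fst e),
    u.potentialMap_toForm e, (u.memLp_image e).coeFn_toLp] with x h1 h2 h3
  rw [h1, Pi.sub_apply, h2]
  change _ - (u.memLp_image e).toLp _ x = _
  rw [h3]
  ring

variable [Fintype E] [DecidableEq V]

/-- A semi-rigid element of `∏_e H²(e) × ∏_v ℂ` satisfies the Euler–Lagrange equations. -/
theorem H2.weak_of_semirigid (u : G.H2) (hu : u.IsSemirigid) (w : G.FormSpace) :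
    ⟪w, G.formOperator u.toForm⟫_ℂ = ⟪G.formEmbed w, u.image⟫_ℂ := by
  rw [H2.semirigid_iff] at hu
  revert w
  rw [formOperator_eq_iff]
  have hint : ∀ e, ∀ t ∈ Set.Icc 0 (G.len e),
      ∫ x in t..G.len e, (G.potentialMap e u.toForm - u.image.fst e) x =
        (G.a : ℂ) * (u.der e (G.len e) - u.der e t) := fun e t ht => by
    rw [← u.integral_der2 e ht, ← intervalIntegral.integral_const_mul,
      intervalIntegral.integral_of_le ht.2, intervalIntegral.integral_of_le ht.2]
    exact integral_congr_ae (ae_restrict_of_ae_restrict_of_subset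
      (Set.Ioc_subset_Ioc_left ht.1) (u.potentialMap_sub_image e))
  refine ⟨fun e => ⟨?_, ?_⟩, fun v => ?_⟩
  · ext1
    set P : Lp ℂ 2 (lebesgueIoc (G.len e)) := G.potentialMap e u.toForm - u.image.fst e with hP
    filter_upwards [ae_mem_Ioc (G.len e), tail_coeFn P, edgeOne_coeFn (G.len e),
      u.derivMap_toForm e, Lp.coeFn_add ((G.a : ℂ) • G.derivMap e u.toForm) (tail P),
      Lp.coeFn_smul (G.a : ℂ) (G.derivMap e u.toForm),
      Lp.coeFn_smul ((G.kappa : ℂ) * G.jumpMap (e, true) u.toForm) (edgeOne (G.len e))]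
      with x hx h1 h2 h3 h4 h5 h6
    rw [h4, Pi.add_apply, h5, h6, Pi.smul_apply, Pi.smul_apply, h1, h2, h3, hP,
      hint e x ⟨hx.1.le, hx.2⟩, smul_eq_mul, smul_eq_mul, mul_one, u.jumpMap_toForm, ← (hu e).1]
    ring
  · have h := hint e 0 ⟨le_rfl, (G.len_pos e).le⟩
    rw [intervalIntegral.integral_of_le (G.len_pos e).le] at h
    rw [h, u.jumpMap_toForm, u.jumpMap_toForm, mul_add, ← (hu e).1, ← (hu e).2]
    ring
  · have hm : (G.mass v : ℂ) ≠ 0 := Complex.ofReal_ne_zero.2 (G.mass_pos v).ne'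
    change _ = (G.mass v : ℂ) * ((G.mass v : ℂ)⁻¹ * u.netForce v)
    rw [mul_inv_cancel_left₀ hm, H2.netForce]
    refine Finset.sum_congr rfl fun p _ => ?_
    obtain ⟨e, b⟩ := p
    rw [u.jumpMap_toForm]
    cases b
    · rw [← (hu e).2]; simp [endSign, endCoord]
    · rw [← (hu e).1]; simp [endSign, endCoord]

/-- Elliptic regularity: a solution of the Euler–Lagrange equations is in `∏_e H²(e) × ∏_v ℂ`, and
satisfies the semi-rigidity conditions. -/
theorem H2.exists_of_weak (k : G.FormSpace) (y : G.L2)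
    (h : ∀ w, ⟪w, G.formOperator k⟫_ℂ = ⟪G.formEmbed w, y⟫_ℂ) :
    ∃ u : G.H2, u.toForm = k ∧ u.IsSemirigid := by
  have ha : (G.a : ℂ) ≠ 0 := Complex.ofReal_ne_zero.2 G.a_pos.ne'
  obtain ⟨he, -⟩ := (G.formOperator_eq_iff k y).1 h
  set P : ∀ e, Lp ℂ 2 (lebesgueIoc (G.len e)) := fun e => G.potentialMap e k - y.fst e with hP
  -- the continuous representative of the derivative
  set d : E → ℝ → ℂ := fun e x => (G.a : ℂ)⁻¹ *
    ((G.kappa : ℂ) * G.jumpMap (e, true) k - ∫ t in x..G.len e, P e t) with hd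
  have hdk : ∀ e, G.derivMap e k =ᵐ[lebesgueIoc (G.len e)] d e := fun e => by
    have h1 := (he e).1
    rw [← eq_sub_iff_add_eq, ← eq_inv_smul_iff₀ ha] at h1
    rw [h1]
    filter_upwards [tail_coeFn (P e), edgeOne_coeFn (G.len e),
      Lp.coeFn_smul (G.a : ℂ)⁻¹ (((G.kappa : ℂ) * G.jumpMap (e, true) k) • edgeOne (G.len e) -
        tail (P e)),
      Lp.coeFn_sub (((G.kappa : ℂ) * G.jumpMap (e, true) k) • edgeOne (G.len e)) (tail (P e)),
      Lp.coeFn_smul ((G.kappa : ℂ) * G.jumpMap (e, true) k) (edgeOne (G.len e))]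
      with x h1 h2 h3 h4 h5
    rw [h3, Pi.smul_apply, h4, Pi.sub_apply, h5, Pi.smul_apply, h1, h2, smul_eq_mul, smul_eq_mul,
      mul_one]
  have hdm : ∀ e, MemLp (d e) 2 (lebesgueIoc (G.len e)) := fun e =>
    (Lp.memLp (G.derivMap e k)).ae_eq (hdk e)
  let u : G.H2 :=
    { val := fun e x => (G.edgePart e k).1 + ∫ t in (0 : ℝ)..x, d e t
      der := d
      vert := G.vertexPart k
      der_memLp := hdm
      val_eq := fun e x _ => by rw [intervalIntegral.integral_same, add_zero]
      der2 := fun e x => (G.a : ℂ)⁻¹ * P e x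
      der2_memLp := fun e => (Lp.memLp (P e)).const_mul _
      der_eq := fun e x hx => by
        have h0 : (0 : ℝ) ∈ Set.Icc 0 (G.len e) := ⟨le_rfl, (G.len_pos e).le⟩
        have hl : G.len e ∈ Set.Icc 0 (G.len e) := ⟨(G.len_pos e).le, le_rfl⟩
        rw [intervalIntegral.integral_const_mul, hd]
        simp only
        rw [← intervalIntegral.integral_add_adjacent_intervals (Lp_intervalIntegrable (P e) h0 hx)
          (Lp_intervalIntegrable (P e) hx hl)]
        ring }
  have hu : u.toForm = k := by
    rw [H1.toForm]
    conv_rhs => rw [← G.formMk_parts k]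
    congr 1
    funext e
    refine Prod.ext (by simp [u]) ?_
    ext1
    filter_upwards [(hdm e).coeFn_toLp, hdk e] with x h1 h2
    exact h1.trans h2.symm
  refine ⟨u, hu, u.semirigid_iff.2 fun e => ?_⟩
  rw [← u.jumpMap_toForm, ← u.jumpMap_toForm, hu]
  have h2 := (he e).2
  constructor
  · change (G.a : ℂ) * d e (G.len e) = _
    rw [hd]
    simp only
    rw [intervalIntegral.integral_same, sub_zero, mul_inv_cancel_left₀ ha]
  · change -((G.a : ℂ) * d e 0) = _
    rw [hd]
    simp only
    rw [intervalIntegral.integral_of_le (G.len_pos e).le, h2, mul_inv_cancel_left₀ ha]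
    ring

end SemirigidGraph

end

theorem mainTheorem7 {V E : Type*} [Fintype V] [DecidableEq V] [Fintype E]
    (G : SemirigidGraph V E) :
    ∃ A : G.L2 →ₗ.[ℂ] G.L2,
      G.IsEnergyOperator A ∧
      Dense (A.domain : Set G.L2) ∧
      IsSelfAdjoint A ∧
      HasCompactResolvent A ∧
      (∀ x : G.L2, x ∈ A.domain ↔ ∃ u : G.H2, u.toL2 = x ∧ u.IsSemirigid) ∧
      (∀ (u : G.H2) (hu : u.toL2 ∈ A.domain), u.IsSemirigid →
        (∀ e, (A ⟨u.toL2, hu⟩).fst e =ᵐ[G.edgeMeasure e]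
          fun x => -(G.a : ℂ) * u.der2 e x + (G.q e x : ℂ) * u.val e x) ∧
        (∀ v, (A ⟨u.toL2, hu⟩).snd v = (G.mass v : ℂ)⁻¹ * u.netForce v)) := by
  obtain ⟨c, d, hd, hcoer⟩ := G.exists_form_coercive
  obtain ⟨A, hgraph, hdense, hself, hcomp⟩ := exists_selfAdjoint_of_form G.formEmbed
    G.formOperator G.eq_zero_of_inner_formEmbed G.isCompactOperator_formEmbed
    G.formOperator_symm hd hcoer
  have himage : ∀ u : G.H2, u.IsSemirigid → (u.toL2, u.image) ∈ A.graph := fun u hu =>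
    (hgraph _ _).2 ⟨u.toForm, u.formEmbed_toForm, u.weak_of_semirigid hu⟩
  refine ⟨A, fun x y => ?_, hdense, hself, hcomp, fun x => ⟨fun hx => ?_, ?_⟩, fun u hu hsr => ?_⟩
  · rw [hgraph]
    constructor
    · rintro ⟨k, rfl, hk⟩
      obtain ⟨u, rfl⟩ := SemirigidGraph.H1.exists_toForm_eq k
      refine ⟨u, u.formEmbed_toForm.symm, fun w => ?_⟩
      rw [SemirigidGraph.energyForm_eq_inner, hk, w.formEmbed_toForm]
    · rintro ⟨u, rfl, hu⟩
      refine ⟨u.toForm, u.formEmbed_toForm, fun k => ?_⟩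
      obtain ⟨w, rfl⟩ := SemirigidGraph.H1.exists_toForm_eq k
      rw [← SemirigidGraph.energyForm_eq_inner, hu, w.formEmbed_toForm]
  · obtain ⟨k, hk, hweak⟩ := (hgraph _ _).1 (A.mem_graph ⟨x, hx⟩)
    obtain ⟨u, rfl, hu⟩ := SemirigidGraph.H2.exists_of_weak k _ hweak
    exact ⟨u, u.formEmbed_toForm.symm.trans hk, hu⟩
  · rintro ⟨u, rfl, hu⟩
    exact LinearPMap.mem_domain_of_mem_graph (himage u hu)
  · have hA : A ⟨u.toL2, hu⟩ = u.image :=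
      LinearPMap.mem_graph_snd_inj' _ (A.mem_graph ⟨u.toL2, hu⟩) (himage u hsr) rfl
    rw [hA]
    exact ⟨fun e => (u.memLp_image e).coeFn_toLp, fun v => rfl⟩
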